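/- Let the regular pentagon have a horizontal bottom side, and label its sides and their midpoints so that $1,2$ are the upper left and upper right sides, $3,4$ the lower left and lower right sides, and $5$ the bottom side. Let $\phi=\frac{1+\sqrt5}{2}$, $$P=\begin{pmatrix}1&\cos(\pi/5)\\0&\sin(\pi/5)\end{pmatrix},\quad \sigma_0=\begin{pmatrix}1&\phi\\0&1\end{pmatrix},\ \sigma_1=\begin{pmatrix}\phi&\phi\\1&\phi\end{pmatrix},\ \sigma_2=\begin{pmatrix}\phi&1\\\phi&\phi\end{pmatrix},\ \sigma_3=\begin{pmatrix}1&0\\\phi&1\end{pmatrix},$$ and in $S_5$ let $\tau_0=(1\,2)(3\,4)$, $\tau_1=(1\,3)(2\,5)$, $\tau_2=(1\,4)(3\,5)$, $\tau_3=(2\,3)(4\,5)$; products of permutations are composed from right to left. A word $k_1\cdots k_n$ in the letters $0,1,2,3$ is a tree word of a vector $x$ if $x=\ell\,\sigma_{k_n}\cdots\sigma_{k_1}\binom{1}{0}$ for some $\ell>0$. Call a direction $v$ periodic if some billiard trajectory in direction $v$ in the pentagon is closed. The length of a periodic trajectory is the distance travelled until its first return, with the same velocity, after an even number of bounces (that is,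 until its unfolding closes up). A trajectory in direction $v$ is called long if it is periodic, its length is the largest one among all periodic trajectories in direction $v$, and some periodic trajectory in direction $v$ is shorter; it is called short if it is periodic, its length is the smallest one, and some periodic trajectory in direction $v$ is longer; it is a saddle connection if it runs into a corner both forwards and backwards. (A trajectory that starts on a side with a velocity pointing out of the table is reflected at once.) **Theorem.** Let $v$ be a periodic billiard direction in the regular pentagon. (a) There are a symmetry $A$ of the pentagon (as a linear isometry, the centre being the origin) and $u\in\{Av,-Av\}$ such that $P^{-1}u$ lies in the first quadrant $\{(x,y):x>0,\ y\ge 0\}$. (b) Let $A$ and $u$ be any such pair (if $P^{-1}v$ is itself in the first quadrant, one can take $A=1$, $u=v$), and let $\pi\in S_5$ be the permutation of the side midpoints induced by $A$. Then $P^{-1}u$ has a tree word, and exactly one that does not begin with $k_1=0$. For every tree word $k_1\cdots k_n$ of $P^{-1}u$, put $\tau=\tau_{k_1}\tau_{k_2}\cdots\tau_{k_n}$. Then for every $J\in\{1,\dots,5\}$ the billiard trajectory from the midpoint of side $J$ in direction $v$ is short if $\tau(\pi(J))\in\{1,2\}$, long if $\tau(\pi(J))\in\{3,4\}$, and a saddle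 connection if $\tau(\pi(J))=5$. -/

import Mathlib

noncomputable section

namespace PentagonBilliard

/-- The Euclidean plane. -/
abbrev Plane : Type := EuclideanSpace ℝ (Fin 2)

/-! ### The billiard table

The sides and their midpoints are labelled by `1, 2, 3, 4, 5` in `Fin 5`, where `5` and `0` are the
same label.  Side `5` is the horizontal bottom side, `1` and `2` are the upper left and upper right
sides, `3` and `4` the lower left and lower right sides. -/

/-- Angle of the outward normal of each side, in the order `5, 1, 2, 3, 4`. -/
def normalAngle : Fin 5 → ℝ :=
  ![3 * Real.pi / 2, 7 * Real.pi / 10, 3 * Real.pi / 10, 11 * Real.pi / 10, 19 * Real.pi / 10]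

/-- Outward unit normal of a side. -/
def normal (j : Fin 5) : Plane := !₂[Real.cos (normalAngle j), Real.sin (normalAngle j)]

/-- The regular pentagon centred at the origin with inradius `1` (closed region). -/
def table : Set Plane := {x | ∀ j, inner ℝ x (normal j) ≤ 1}

/-- Side `j` without its two end points. -/
def openSide (j : Fin 5) : Set Plane :=
  {x | inner ℝ x (normal j) = 1 ∧ ∀ i, i ≠ j → inner ℝ x (normal i) < 1}

/-- The corners of the table. -/
def corners : Set Plane :=
  {x | x ∈ table ∧ ∃ i j, i ≠ j ∧ inner ℝ x (normal i) = 1 ∧ inner ℝ x (normal j) = 1}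

/-- Midpoint of side `j`: as the inradius is `1`, it is the foot of the perpendicular from the
centre, which is the unit normal itself. -/
def sideMid (j : Fin 5) : Plane := normal j

/-- Mirror reflection of a velocity in side `j`. -/
def reflect (j : Fin 5) (u : Plane) : Plane := u - (2 * inner ℝ u (normal j)) • normal j

/-! ### Billiard trajectories -/

/-- `BilliardPath p v n L q w`: the billiard ball which starts at `p` with velocity `v` is, after
`n` bounces off the sides and after having travelled the distance `L`, at the point `q` with
velocity `w`, where (for `n > 0`) `q` is the point of the last bounce and `w` is the velocity just
after it.  The ball flies straight until it meets a side, away from the corners, and is then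
reflected.  A flight time `t = 0` occurs only for a start on a side with a velocity pointing out of
the table, which is reflected at once. -/
inductive BilliardPath (p v : Plane) : ℕ → ℝ → Plane → Plane → Prop
  | start : BilliardPath p v 0 0 p v
  | bounce {n : ℕ} {L : ℝ} {q w : Plane} (h : BilliardPath p v n L q w) (t : ℝ) (ht : 0 ≤ t)
      (j : Fin 5) (hside : q + t • w ∈ openSide j) (hout : 0 < inner ℝ w (normal j)) :
      BilliardPath p v (n + 1) (L + ‖t • w‖) (q + t • w) (reflect j w)

/-- The trajectory from `p` with velocity `v` is back at `p` with velocity `v` after `n` bounces and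
after having travelled the distance `L`. -/
def ReturnsAfter (p v : Plane) (n : ℕ) (L : ℝ) : Prop :=
  ∃ (L₀ : ℝ) (q : Plane) (s : ℝ),
    BilliardPath p v n L₀ q v ∧ 0 ≤ s ∧ p = q + s • v ∧ L = L₀ + ‖s • v‖

/-- A direction is periodic if some billiard trajectory in this direction is closed. -/
def IsPeriodicDirection (v : Plane) : Prop :=
  v ≠ 0 ∧ ∃ p ∈ table, ∃ n, 0 < n ∧ ∃ L, ReturnsAfter p v n L

/-- The trajectory from `p` in direction `v` is periodic and has length `L`.  Only returns after an
even number of bounces count: these are the ones at which the unfolded straight line closes up on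
the translation surface (a path which returns after an odd number of bounces is traversed twice,
and then has the same length as the closed paths parallel to it). -/
def HasLength (p v : Plane) (L : ℝ) : Prop :=
  IsLeast {T | ∃ n, 0 < n ∧ Even n ∧ ReturnsAfter p v n T} L

/-- The lengths of all periodic billiard trajectories in direction `v`. -/
def lengths (v : Plane) : Set ℝ := {L | ∃ p ∈ table, HasLength p v L}

/-- The trajectory from `p` in direction `v` is periodic, it is one of the longest periodic
trajectories in direction `v`, and there are shorter ones. -/
def IsLong (p v : Plane) : Prop :=
  ∃ L, HasLength p v L ∧ IsGreatest (lengths v) L ∧ ∃ L' ∈ lengths v, L' < L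

/-- The trajectory from `p` in direction `v` is periodic, it is one of the shortest periodic
trajectories in direction `v`, and there are longer ones. -/
def IsShort (p v : Plane) : Prop :=
  ∃ L, HasLength p v L ∧ IsLeast (lengths v) L ∧ ∃ L' ∈ lengths v, L < L'

/-- The trajectory from `p` with velocity `v` runs into a corner. -/
def HitsCorner (p v : Plane) : Prop :=
  ∃ (n : ℕ) (L : ℝ) (q w : Plane) (t : ℝ), BilliardPath p v n L q w ∧ 0 ≤ t ∧ q + t • w ∈ corners

/-- The trajectory through `p` in direction `v` is (part of) a saddle connection: followed forwards
as well as backwards it runs into a corner. -/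
def IsSaddleConnection (p v : Plane) : Prop := HitsCorner p v ∧ HitsCorner p (-v)

/-! ### Tree words -/

/-- The matrix which takes the golden L to the double pentagon. -/
def P : Matrix (Fin 2) (Fin 2) ℝ := !![1, Real.cos (Real.pi / 5); 0, Real.sin (Real.pi / 5)]

/-- The direction `P⁻¹ v` on the golden L. -/
def toGoldenL (v : Plane) : Fin 2 → ℝ := P⁻¹.mulVec v.ofLp

/-- The first quadrant (without the vertical direction). -/
def InFirstQuadrant (x : Fin 2 → ℝ) : Prop := 0 < x 0 ∧ 0 ≤ x 1

/-- The generators `σ₀, σ₁, σ₂, σ₃` of the Veech group of the golden L. -/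
def sigma : Fin 4 → Matrix (Fin 2) (Fin 2) ℝ :=
  ![!![1, Real.goldenRatio; 0, 1],
    !![Real.goldenRatio, Real.goldenRatio; 1, Real.goldenRatio],
    !![Real.goldenRatio, 1; Real.goldenRatio, Real.goldenRatio],
    !![1, 0; Real.goldenRatio, 1]]

/-- For the word `[k₁, …, kₙ]`, the vector `σ_{kₙ} ⋯ σ_{k₁} (1, 0)`. -/
def wordVector (a : List (Fin 4)) : Fin 2 → ℝ :=
  a.foldl (fun x k => (sigma k).mulVec x) ![1, 0]

/-- The word `a` is a tree word of the vector `x`: `x = ℓ σ_{kₙ} ⋯ σ_{k₁} (1, 0)`, `ℓ > 0`. -/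
def IsTreeWord (a : List (Fin 4)) (x : Fin 2 → ℝ) : Prop := ∃ l : ℝ, 0 < l ∧ x = l • wordVector a

/-- The permutations `τ₀ = (1 2)(3 4)`, `τ₁ = (1 3)(2 5)`, `τ₂ = (1 4)(3 5)`, `τ₃ = (2 3)(4 5)`. -/
def tau : Fin 4 → Equiv.Perm (Fin 5) :=
  ![Equiv.swap 1 2 * Equiv.swap 3 4, Equiv.swap 1 3 * Equiv.swap 2 5,
    Equiv.swap 1 4 * Equiv.swap 3 5, Equiv.swap 2 3 * Equiv.swap 4 5]

/-- For the word `[k₁, …, kₙ]`, the permutation `τ_{k₁} ⋯ τ_{kₙ}` (the last factor acts first). -/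
def wordPerm (a : List (Fin 4)) : Equiv.Perm (Fin 5) := (a.map tau).prod

/-- The linear isometry `A` is a symmetry of the table and permutes the sides according to `π`. -/
def IsTableSymmetry (A : Plane ≃ₗᵢ[ℝ] Plane) (π : Equiv.Perm (Fin 5)) : Prop :=
  ∀ j, A (sideMid j) = sideMid (π j)

end PentagonBilliard

end

open PentagonBilliard

/-! Reflection in a side is the half turn about its midpoint composed with the symmetry of the table
that fixes this midpoint. Modulo symmetries of the table the ball therefore always flies along `u`
or `-u`, and a bounce is a half turn about a side midpoint. Recording only the sign of the velocity
and the coordinate transverse to `u` leaves a one-dimensional system, whose intervals have centres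
and half-widths (`center`, `width`) that are golden-linear in `s = P⁻¹ u`.

The same linear formulas are read in the ring `ℝ × ℝ × ZMod 5` with golden ratio `(φ, φ, 3)`: the
first coordinate is the transverse position, the second keeps track of flight time, the third of the
rotation accumulated by unfolding. A closed line is a return up to a displacement `δ` with `proj δ =
0`, and `δ` determines its length (`returnsAfter_iff`).

Renormalization: side `tau k j` of the system of `σₖ s` contains, around its midpoint, a copy of
side `j` of the system of `s`. Between two visits to such inner parts the ball follows one chord of
the smaller system (`climb`, `corner_chain`). Hence lifting preserves displacements up to sign, and
midpoints are permuted by `tau k` (`ret_lift`, `dies_center_act`). Along a tree word everything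
reduces to the horizontal direction, where sides 1, 2 and sides 3, 4 bound two cylinders with
periods `2 g q` and `2 g² q`, and the bottom side is seen edge-on (`cyc_horizontal`, `classify`). As
`2 g` and `2 g²` are units modulo 5, both cylinders close after the same number of turns, so the
lengths have ratio `φ`.

A periodic direction has a tree word by descent on the number of bounces (`exists_treeWord`): going
down through the cone of `σₖ` that contains it removes bounces, unless only inner parts are met, and
then the ball drifts and cannot close up (`not_innerPath`). The reduced word is unique because the
cones are disjoint and `σ₀` fixes `(1, 0)`. -/

namespace PentagonBilliard
open Real

/-! ### The transverse system of a direction over a golden ring -/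

/-- A commutative ring with a solution `g` of `g² = g + 1` and a real-valued coordinate. -/
class GoldenRing (K : Type*) extends CommRing K where
  gen : K
  gen_sq : gen ^ 2 = gen + 1
  coord : K →+* ℝ
  coord_gen : coord gen = goldenRatio

variable {K : Type*} [GoldenRing K]

/-- The golden ratio of a golden ring. -/
def g : K := GoldenRing.gen

theorem g_sq : (g : K) ^ 2 = g + 1 := GoldenRing.gen_sq

/-- The real coordinate of an element of a golden ring. -/
def proj (x : K) : ℝ := (GoldenRing.coord : K →+* ℝ) x

@[simp] theorem proj_add (x y : K) : proj (x + y) = proj x + proj y := map_add _ x y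
@[simp] theorem proj_sub (x y : K) : proj (x - y) = proj x - proj y := map_sub _ x y
@[simp] theorem proj_neg (x : K) : proj (-x) = -proj x := map_neg _ x
@[simp] theorem proj_mul (x y : K) : proj (x * y) = proj x * proj y := map_mul _ x y
@[simp] theorem proj_zero : proj (0 : K) = 0 := map_zero _
@[simp] theorem proj_one : proj (1 : K) = 1 := map_one _
@[simp] theorem proj_ofNat (n : ℕ) [n.AtLeastTwo] : proj (ofNat(n) : K) = ofNat(n) :=
  map_ofNat _ n
@[simp] theorem proj_g : proj (g : K) = goldenRatio := GoldenRing.coord_gen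

/-- The sides which a ball flying forwards can meet. -/
def isFwd : Fin 5 → Bool := ![false, false, true, false, true]

/-- Midpoints of the sides in the transverse coordinate. -/
def center (s : K × K) : Fin 5 → K :=
  ![s.2, (2 * g + 1) * s.1 + (2 * g + 2) * s.2, (2 * g + 1) * s.1 + (g + 2) * s.2,
    g * s.1 + (g + 2) * s.2, g * s.1 + s.2]

/-- Half of the transverse width of the sides. -/
def width (s : K × K) : Fin 5 → K :=
  ![s.2, s.1, s.1 + g * s.2, g * s.1 + g * s.2, g * s.1 + s.2]

/-- The matrices `σₖ` over a golden ring. -/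
def act (k : Fin 4) (s : K × K) : K × K :=
  ![(s.1 + g * s.2, s.2), (g * s.1 + g * s.2, s.1 + g * s.2),
    (g * s.1 + s.2, g * s.1 + g * s.2), (s.1, g * s.1 + s.2)] k

/-- The state `ω` runs into the interior of side `j`. -/
def Heads (s : K × K) (j : Fin 5) (ω : Bool × K) : Prop :=
  isFwd j = ω.1 ∧ |proj (ω.2 - center s j)| < proj (width s j)

/-- The state after the half turn about the midpoint of side `j`. -/
def bounce (s : K × K) (j : Fin 5) (ω : Bool × K) : Bool × K := (!ω.1, 2 * center s j - ω.2)

/-- The state `ω` runs into a corner. -/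
def Dead (s : K × K) (ω : Bool × K) : Prop :=
  ∃ j, isFwd j = ω.1 ∧ 0 < proj (width s j) ∧ |proj (ω.2 - center s j)| = proj (width s j)

/-- The reversed state. -/
def rev (ω : Bool × K) : Bool × K := (!ω.1, ω.2)

/-- Cone of admissible directions. -/
def Admissible (s : K × K) : Prop := 0 < proj s.1 ∧ 0 ≤ proj s.2

/-- Expansion in `s.1`, `g * s.1`, `s.2`, `g * s.2`, with `g ^ 2` eliminated, makes all later
comparisons of end points linear in these four quantities. -/
theorem center_act (k : Fin 4) (s : K × K) (j : Fin 5) : center (act k s) j =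
    ![![s.2, s.1 + 2 * (g * s.1) + 4 * s.2 + 5 * (g * s.2),
        s.1 + 2 * (g * s.1) + 4 * s.2 + 4 * (g * s.2), g * s.1 + 3 * s.2 + 2 * (g * s.2),
        g * s.1 + 2 * s.2 + g * s.2],
      ![s.1 + g * s.2, 4 * s.1 + 5 * (g * s.1) + 4 * s.2 + 7 * (g * s.2),
        4 * s.1 + 4 * (g * s.1) + 3 * s.2 + 6 * (g * s.2),
        3 * s.1 + 2 * (g * s.1) + 2 * s.2 + 4 * (g * s.2),
        2 * s.1 + g * s.1 + s.2 + 2 * (g * s.2)],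
      ![g * s.1 + g * s.2, 4 * s.1 + 7 * (g * s.1) + 3 * s.2 + 6 * (g * s.2),
        3 * s.1 + 6 * (g * s.1) + 2 * s.2 + 5 * (g * s.2),
        2 * s.1 + 4 * (g * s.1) + s.2 + 4 * (g * s.2),
        s.1 + 2 * (g * s.1) + 2 * (g * s.2)],
      ![g * s.1 + s.2, 3 * s.1 + 6 * (g * s.1) + 2 * s.2 + 2 * (g * s.2),
        2 * s.1 + 5 * (g * s.1) + 2 * s.2 + g * s.2, s.1 + 4 * (g * s.1) + 2 * s.2 + g * s.2,
        2 * (g * s.1) + s.2]] k j := by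
  fin_cases k <;> fin_cases j <;> simp [center, act] <;> ring_nf <;> simp only [g_sq] <;> ring

theorem width_act (k : Fin 4) (s : K × K) (j : Fin 5) : width (act k s) j =
    ![![s.2, s.1 + g * s.2, s.1 + 2 * (g * s.2), g * s.1 + s.2 + 2 * (g * s.2),
        g * s.1 + 2 * s.2 + g * s.2],
      ![s.1 + g * s.2, g * s.1 + g * s.2, 2 * (g * s.1) + s.2 + 2 * (g * s.2),
        s.1 + 2 * (g * s.1) + 2 * s.2 + 2 * (g * s.2), 2 * s.1 + g * s.1 + s.2 + 2 * (g * s.2)],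
      ![g * s.1 + g * s.2, g * s.1 + s.2, s.1 + 2 * (g * s.1) + 2 * s.2 + g * s.2,
        2 * s.1 + 2 * (g * s.1) + s.2 + 2 * (g * s.2), s.1 + 2 * (g * s.1) + 2 * (g * s.2)],
      ![g * s.1 + s.2, s.1, 2 * s.1 + g * s.1 + g * s.2, s.1 + 2 * (g * s.1) + g * s.2,
        2 * (g * s.1) + s.2]] k j := by
  fin_cases k <;> fin_cases j <;> simp [width, act] <;> ring_nf <;> simp only [g_sq] <;> ring

end PentagonBilliard

/-! ### Comparison of the systems of `s` and `act k s`: finite checks -/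

namespace PentagonBilliard
open Real
variable {K : Type*} [GoldenRing K]

theorem tau_apply (k : Fin 4) (j : Fin 5) : tau k j =
    ![![0, 2, 1, 4, 3], ![2, 3, 0, 1, 4], ![3, 4, 2, 0, 1], ![4, 1, 3, 2, 0]] k j := by
  revert k j; decide

/-- Position in the system of `act k s` of a ball which is about to meet side `j` at `x` in the
system of `s`. -/
def lift (k : Fin 4) (s : K × K) (j : Fin 5) (x : K) : Bool × K :=
  (isFwd (tau k j), if isFwd (tau k j) = isFwd j then center (act k s) (tau k j) + (x - center s j)
    else center (act k s) (tau k j) - (x - center s j))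

/-- The ball meets side `j` of the system of `act k s` outside of the part which is a side of the
system of `s`. -/
def MeetsOuter (k : Fin 4) (s : K × K) (j : Fin 5) (ω : Bool × K) : Prop :=
  Heads (act k s) j ω ∧ proj (width s (tau k j)) ≤ |proj (ω.2 - center (act k s) j)|

/-- `η` is reached from `ω` by meeting the outer parts of the sides in the list. -/
def OuterChain (k : Fin 4) (s : K × K) : List (Fin 5) → Bool × K → Bool × K → Prop
  | [], ω, η => ω = η
  | j :: l, ω, η => MeetsOuter k s j ω ∧ OuterChain k s l (bounce (act k s) j ω) η

/-- The chords from a backward to a forward side are 0→4, 3→4, 3→2 and 1→2. Entry `k` lists, in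
order, the sides whose outer parts are met while such a chord is followed in the system of `act k
s`. -/
def climbSides (k : Fin 4) (i : Fin 5) (j : Fin 5) : List (Fin 5) :=
  if j = 4 then (if i = 0 then ![[4], [3], [2], []] k else ![[], [2, 3], [4, 3, 2], [3, 4]] k)
  else (if i = 1 then ![[], [4], [3], [2]] k else ![[3, 2], [2, 3, 4], [4, 3], []] k)

/-- With `a`, `φ a`, `b`, `φ b` as independent unknowns, these rational bounds suffice for linear
arithmetic to decide the interval comparisons below. -/
theorem golden_mul_bounds {a : ℝ} (h : 0 ≤ a) :
    1.6 * a ≤ goldenRatio * a ∧ goldenRatio * a ≤ 1.62 * a := by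
  have h1 : (1.6 : ℝ) ≤ goldenRatio := by
    have : (2.2 : ℝ) ≤ √5 := Real.le_sqrt_of_sq_le (by norm_num)
    rw [goldenRatio]; linarith
  have h2 : goldenRatio ≤ (1.62 : ℝ) := by
    have : √5 ≤ (2.24 : ℝ) := Real.sqrt_le_iff.2 (by norm_num)
    rw [goldenRatio]; linarith
  exact ⟨by gcongr, by gcongr⟩

set_option maxHeartbeats 2000000 in
theorem climb_fwd (k : Fin 4) {s : K × K} (hs : Admissible s) {i j : Fin 5} {x : K}
    (hi : isFwd i = false) (hj : isFwd j = true)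
    (hxi : |proj (x - center s i)| < proj (width s i))
    (hxj : |proj (x - center s j)| < proj (width s j)) :
    OuterChain k s (climbSides k i j) (rev (lift k s i x)) (lift k s j x) := by
  obtain ⟨ha, hb⟩ := hs
  obtain ⟨ha1, ha2⟩ := golden_mul_bounds ha.le
  obtain ⟨hb1, hb2⟩ := golden_mul_bounds hb
  have hi' : i = 0 ∨ i = 1 ∨ i = 3 := (by decide : ∀ i, isFwd i = false → i = 0 ∨ i = 1 ∨ i = 3) i hi
  have hj' : j = 2 ∨ j = 4 := (by decide : ∀ j, isFwd j = true → j = 2 ∨ j = 4) j hj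
  rw [abs_lt] at hxi hxj
  obtain ⟨hxi1, hxi2⟩ := hxi
  obtain ⟨hxj1, hxj2⟩ := hxj
  clear hi hj
  rcases hi' with rfl | rfl | rfl <;> rcases hj' with rfl | rfl <;> fin_cases k <;>
    simp [center, width, add_mul] at hxi1 hxi2 hxj1 hxj2 <;>
    first
    | (exfalso; linarith)
    | (simp [climbSides, OuterChain, MeetsOuter, Heads, bounce, rev, lift, tau_apply, isFwd,
        center_act, width_act, abs_lt, le_abs]
       try simp [center, width, add_mul]
       (try constructorm* _ ∧ _) <;>
         first | linarith | ring1 | (left; linarith) | (right; linarith))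

end PentagonBilliard

namespace PentagonBilliard
open Real
variable {K : Type*} [GoldenRing K]

theorem isFwd_eq_false {i : Fin 5} (h : isFwd i = false) : i = 0 ∨ i = 1 ∨ i = 3 := by
  revert i; decide

theorem isFwd_eq_true {i : Fin 5} (h : isFwd i = true) : i = 2 ∨ i = 4 := by
  revert i; decide

/-- The corners which lie opposite to the interior of a side. -/
theorem corner_opposite {s : K × K} (hs : Admissible s) {i : Fin 5} {x : K}
    (hx : |proj (x - center s i)| < proj (width s i)) (hd : Dead s (!isFwd i, x)) :
    (i = 3 ∧ proj x = 2 * (goldenRatio * proj s.1 + proj s.2)) ∨ (i = 4 ∧ proj x = 2 * proj s.2) ∨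
      (i = 2 ∧ proj x = 2 * (goldenRatio * proj s.1 + goldenRatio * proj s.2 + proj s.2)) := by
  obtain ⟨ha, hb⟩ := hs
  obtain ⟨ha1, ha2⟩ := golden_mul_bounds ha.le
  obtain ⟨hb1, hb2⟩ := golden_mul_bounds hb
  obtain ⟨j, hj, hw, hd⟩ := hd
  rw [abs_lt] at hx
  obtain ⟨hx1, hx2⟩ := hx
  rw [abs_eq hw.le] at hd
  rcases h : isFwd i with _ | _
  · have hj' := isFwd_eq_true (i := j) (by simpa [h] using hj)
    have hi' := isFwd_eq_false h
    clear hj h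
    rcases hi' with rfl | rfl | rfl <;> rcases hj' with rfl | rfl <;>
      simp [center, width, add_mul] at hx1 hx2 hw hd ⊢ <;> rcases hd with hd | hd <;> linarith
  · have hj' := isFwd_eq_false (i := j) (by simpa [h] using hj)
    have hi' := isFwd_eq_true h
    clear hj h
    rcases hi' with rfl | rfl <;> rcases hj' with rfl | rfl | rfl <;>
      simp [center, width, add_mul] at hx1 hx2 hw hd ⊢ <;> rcases hd with hd | hd <;> linarith

/-- Sides met between the interior of side `i` and the corner opposite to it. -/
def cornerSides (k : Fin 4) (i : Fin 5) : List (Fin 5) :=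
  if i = 3 then ![[3], [2, 3, 4], [4, 3, 2], [3]] k
  else if i = 4 then ![[4], [3, 2], [2, 3], [4]] k else ![[2], [4, 3], [3, 4], [2]] k

theorem Dead.intro {s : K × K} {ω : Bool × K} (j : Fin 5) (hj : isFwd j = ω.1)
    (hw : 0 < proj (width s j))
    (h : proj (ω.2 - center s j) = proj (width s j) ∨ proj (ω.2 - center s j) = -proj (width s j)) :
    Dead s ω :=
  ⟨j, hj, hw, (abs_eq hw.le).2 h⟩

set_option maxHeartbeats 2000000 in
-- Counterpart of `climb_fwd` for a chord that ends in a corner: the lifted ball ends in a corner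
-- too, so a singular trajectory cannot become regular by lifting.
theorem corner_chain (k : Fin 4) {s : K × K} (hs : Admissible s) {i : Fin 5} {x : K}
    (hx : |proj (x - center s i)| < proj (width s i)) (hd : Dead s (!isFwd i, x)) :
    ∃ η, OuterChain k s (cornerSides k i) (rev (lift k s i x)) η ∧ Dead (act k s) η := by
  have hc := corner_opposite hs hx hd
  obtain ⟨ha, hb⟩ := hs
  obtain ⟨ha1, ha2⟩ := golden_mul_bounds ha.le
  obtain ⟨hb1, hb2⟩ := golden_mul_bounds hb
  rw [abs_lt] at hx
  obtain ⟨hx1, hx2⟩ := hx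
  clear hd
  rcases hc with ⟨rfl, hc⟩ | ⟨rfl, hc⟩ | ⟨rfl, hc⟩ <;> fin_cases k <;>
    simp [center, width, add_mul] at hx1 hx2 <;>
    simp [cornerSides, OuterChain, MeetsOuter, Heads, bounce, rev, lift, tau_apply, isFwd,
      center_act, width_act, abs_lt, le_abs, and_assoc] <;>
    simp [center, width, add_mul] <;>
    (repeat' apply And.intro) <;>
    first
    | linarith
    | (left; linarith)
    | (right; linarith)
    | exact Dead.intro 3 rfl (by simp [width_act]; linarith)
        (Or.inl (by simp [center_act, width_act]; linarith))
    | exact Dead.intro 3 rfl (by simp [width_act]; linarith)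
        (Or.inr (by simp [center_act, width_act]; linarith))
    | exact Dead.intro 2 rfl (by simp [width_act]; linarith)
        (Or.inr (by simp [center_act, width_act]; linarith))

set_option maxHeartbeats 2000000 in
-- Write `(a, b)` for the projection of `s`. Seen along the flight, the backward sides 0, 3, 1 and
-- the forward sides 4, 2 fill the same interval. The break points are `2b` and `2(φa + φb + b)` for
-- the former and `2(φa + b)` for the latter.
theorem heads_or_dead {s : K × K} (hs : Admissible s) {i : Fin 5} {x : K}
    (hx : |proj (x - center s i)| < proj (width s i)) :
    (∃ j, Heads s j (!isFwd i, x)) ∨ Dead s (!isFwd i, x) := by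
  obtain ⟨ha, hb⟩ := hs
  obtain ⟨ha1, ha2⟩ := golden_mul_bounds ha.le
  obtain ⟨hb1, hb2⟩ := golden_mul_bounds hb
  rw [abs_lt] at hx
  obtain ⟨hx1, hx2⟩ := hx
  rcases h : isFwd i with _ | _
  · have hi' := isFwd_eq_false h
    clear h
    rcases lt_trichotomy (proj x) (2 * (goldenRatio * proj s.1 + proj s.2)) with h | h | h
    · refine Or.inl ⟨4, rfl, ?_⟩
      rw [abs_lt]
      rcases hi' with rfl | rfl | rfl <;> simp [center, width, add_mul] at hx1 hx2 ⊢ <;>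
        constructor <;> linarith
    · refine Or.inr ⟨4, rfl, ?_, ?_⟩
      · simp [width]; linarith
      · rw [show proj (x - center s 4) = proj (width s 4) by simp [center, width]; linarith,
          abs_of_nonneg (by simp [width]; linarith)]
    · refine Or.inl ⟨2, rfl, ?_⟩
      rw [abs_lt]
      rcases hi' with rfl | rfl | rfl <;> simp [center, width, add_mul] at hx1 hx2 ⊢ <;>
        constructor <;> linarith
  · have hi' := isFwd_eq_true h
    clear h
    rcases lt_trichotomy (proj x) (2 * proj s.2) with h | h | h
    · refine Or.inl ⟨0, rfl, ?_⟩
      rw [abs_lt]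
      rcases hi' with rfl | rfl <;> simp [center, width, add_mul] at hx1 hx2 ⊢ <;>
        constructor <;> linarith
    · refine Or.inr ⟨3, rfl, ?_, ?_⟩
      · simp [width]; linarith
      · rw [show proj (x - center s 3) = -proj (width s 3) by simp [center, width]; linarith,
          abs_neg, abs_of_nonneg (by simp [width]; linarith)]
    rcases lt_trichotomy (proj x) (2 * (goldenRatio * proj s.1 + goldenRatio * proj s.2 + proj s.2))
      with h' | h' | h'
    · refine Or.inl ⟨3, rfl, ?_⟩
      rw [abs_lt]
      rcases hi' with rfl | rfl <;> simp [center, width, add_mul] at hx1 hx2 ⊢ <;>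
        constructor <;> linarith
    · refine Or.inr ⟨3, rfl, ?_, ?_⟩
      · simp [width]; linarith
      · rw [show proj (x - center s 3) = proj (width s 3) by simp [center, width]; linarith,
          abs_of_nonneg (by simp [width]; linarith)]
    · refine Or.inl ⟨1, rfl, ?_⟩
      rw [abs_lt]
      rcases hi' with rfl | rfl <;> simp [center, width, add_mul] at hx1 hx2 ⊢ <;>
        constructor <;> linarith

/-- Sides 0 and 1 have no outer part: they are exactly as wide as the side of the smaller system
that they contain. -/
theorem MeetsOuter.eq_three {k : Fin 4} {s : K × K} {j : Fin 5} {ω : Bool × K}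
    (h : MeetsOuter k s j ω) (hω : ω.1 = false) : j = 3 := by
  obtain ⟨⟨h1, h2⟩, h3⟩ := h
  have h4 := h3.trans_lt h2
  rcases isFwd_eq_false (h1.trans hω) with rfl | rfl | rfl
  · exfalso; revert h4
    fin_cases k <;> simp [tau_apply, width, act]
  · exfalso; revert h4
    fin_cases k <;> simp [tau_apply, width, act]
  · rfl

set_option maxHeartbeats 2000000 in
/-- The ball cannot meet three outer parts of sides in a row if the first one is a backward side. -/
theorem not_meetsOuter_three {k : Fin 4} {s : K × K} (hs : Admissible s) {x : K} {j : Fin 5}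
    (h1 : MeetsOuter k s 3 (false, x)) (h2 : MeetsOuter k s j (bounce (act k s) 3 (false, x)))
    (h3 : MeetsOuter k s 3 (bounce (act k s) j (bounce (act k s) 3 (false, x)))) : False := by
  obtain ⟨ha, hb⟩ := hs
  obtain ⟨ha1, ha2⟩ := golden_mul_bounds ha.le
  obtain ⟨hb1, hb2⟩ := golden_mul_bounds hb
  have hj : j = 2 ∨ j = 4 := isFwd_eq_true h2.1.1
  obtain ⟨⟨-, h1⟩, h1'⟩ := h1
  obtain ⟨⟨-, h2⟩, h2'⟩ := h2
  obtain ⟨⟨-, h3⟩, h3'⟩ := h3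
  rcases hj with rfl | rfl <;> fin_cases k <;>
    simp [bounce, tau_apply, center_act, width_act, abs_lt, le_abs] at h1 h2 h3 h1' h2' h3' <;>
    simp [width] at h1' h2' h3' <;>
    rcases h1' with h1' | h1' <;> rcases h2' with h2' | h2' <;> linarith

end PentagonBilliard

/-! ### Paths, returns and periods -/

namespace PentagonBilliard
open Real
variable {K : Type*} [GoldenRing K]

/-- `η` is reached from `ω` after `n` bounces. -/
inductive Path (s : K × K) : ℕ → Bool × K → Bool × K → Prop
  | nil (ω : Bool × K) : Path s 0 ω ω
  | cons {n : ℕ} {ω η : Bool × K} (j : Fin 5) (h : Heads s j ω) (p : Path s n (bounce s j ω) η) :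
      Path s (n + 1) ω η

section basic
variable {s : K × K} {ω η ζ : Bool × K} {n m : ℕ} {i j : Fin 5}

theorem Heads.unique (hs : Admissible s) (hi : Heads s i ω) (hj : Heads s j ω) : i = j := by
  obtain ⟨ha, hb⟩ := hs
  obtain ⟨ha1, ha2⟩ := golden_mul_bounds ha.le
  obtain ⟨hb1, hb2⟩ := golden_mul_bounds hb
  obtain ⟨h1, h2⟩ := hi
  obtain ⟨h3, h4⟩ := hj
  rw [abs_lt] at h2 h4
  obtain ⟨h2, h5⟩ := h2
  obtain ⟨h4, h6⟩ := h4
  rcases h : ω.1 with _ | _ <;> rw [h] at h1 h3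
  · rcases isFwd_eq_false h1 with rfl | rfl | rfl <;> rcases isFwd_eq_false h3 with rfl | rfl | rfl <;>
      first
      | rfl
      | (exfalso; clear h1 h3; simp [center, width, add_mul] at h2 h5 h4 h6; linarith)
  · rcases isFwd_eq_true h1 with rfl | rfl <;> rcases isFwd_eq_true h3 with rfl | rfl <;>
      first
      | rfl
      | (exfalso; clear h1 h3; simp [center, width, add_mul] at h2 h5 h4 h6; linarith)

theorem Dead.not_heads (hs : Admissible s) (hd : Dead s ω) : ¬ Heads s i ω := by
  intro hi
  obtain ⟨ha, hb⟩ := hs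
  obtain ⟨ha1, ha2⟩ := golden_mul_bounds ha.le
  obtain ⟨hb1, hb2⟩ := golden_mul_bounds hb
  obtain ⟨h1, h2⟩ := hi
  obtain ⟨j, h3, hw, h4⟩ := hd
  rw [abs_lt] at h2
  rw [abs_eq hw.le] at h4
  obtain ⟨h2, h5⟩ := h2
  rcases h : ω.1 with _ | _ <;> rw [h] at h1 h3
  · rcases isFwd_eq_false h1 with rfl | rfl | rfl <;> rcases isFwd_eq_false h3 with rfl | rfl | rfl <;>
      clear h1 h3 <;> simp [center, width, add_mul] at h2 h5 h4 hw <;> rcases h4 with h4 | h4 <;> linarith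
  · rcases isFwd_eq_true h1 with rfl | rfl <;> rcases isFwd_eq_true h3 with rfl | rfl <;>
      clear h1 h3 <;> simp [center, width, add_mul] at h2 h5 h4 hw <;> rcases h4 with h4 | h4 <;> linarith

theorem Admissible.act (hs : Admissible s) (k : Fin 4) : Admissible (act k s) := by
  obtain ⟨ha, hb⟩ := hs
  have := goldenRatio_pos
  fin_cases k <;> simp [PentagonBilliard.act, Admissible] <;> constructor <;> positivity

theorem Path.eq_of_zero (h : Path s 0 ω η) : ω = η := by cases h; rfl

theorem Path.exists_heads (h : Path s n ω η) (hj : Heads s j η) : ∃ i, Heads s i ω := by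
  cases h with
  | nil => exact ⟨j, hj⟩
  | cons i h _ => exact ⟨i, h⟩

theorem Path.trans (h : Path s n ω η) (h' : Path s m η ζ) : Path s (n + m) ω ζ := by
  induction h with
  | nil => simpa using h'
  | cons j h p ih => rw [Nat.add_right_comm]; exact .cons j h (ih h')

theorem Path.snoc (h : Path s n ω η) (hj : Heads s j η) : Path s (n + 1) ω (bounce s j η) :=
  h.trans (.cons j hj (.nil _))

theorem Path.exists_snoc (h : Path s (n + 1) ω η) :
    ∃ ζ j, Path s n ω ζ ∧ Heads s j ζ ∧ η = bounce s j ζ := by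
  induction n generalizing ω with
  | zero =>
    obtain _ | ⟨j, h, p⟩ := h
    cases p
    exact ⟨ω, j, .nil _, h, rfl⟩
  | succ n ih =>
    obtain _ | ⟨j, h, p⟩ := h
    obtain ⟨ζ, i, h1, h2, h3⟩ := ih p
    exact ⟨ζ, i, .cons j h h1, h2, h3⟩

theorem Path.tail_of_heads (hs : Admissible s) (hj : Heads s j ω) (h : Path s (n + 1) ω η) :
    Path s n (bounce s j ω) η := by
  obtain _ | ⟨i, h, p⟩ := h
  rwa [hj.unique hs h]

theorem bounce_rev_bounce : rev (bounce s j (rev (bounce s j ω))) = ω := by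
  ext <;> simp [rev, bounce]

theorem Heads.rev_bounce (h : Heads s j ω) : Heads s j (rev (bounce s j ω)) := by
  refine ⟨by simp [rev, bounce, h.1], ?_⟩
  rw [show (rev (bounce s j ω)).2 - center s j = -(ω.2 - center s j) by simp [rev, bounce]; ring,
    proj_neg, abs_neg]
  exact h.2

theorem bounce_injective (hs : Admissible s) (hi : Heads s i ω) (hj : Heads s j η)
    (h : bounce s i ω = bounce s j η) : ω = η := by
  have h1 := hi.rev_bounce
  rw [h] at h1
  obtain rfl := h1.unique hs hj.rev_bounce
  rw [← bounce_rev_bounce (s := s) (j := i) (ω := ω), h, bounce_rev_bounce]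

/-- The ball is back after at least one bounce, up to a displacement `δ` along the direction of
flight. -/
def Ret (s : K × K) (ω : Bool × K) (δ : K) : Prop :=
  ∃ n, 0 < n ∧ Path s n ω (ω.1, ω.2 + δ) ∧ proj δ = 0

theorem Heads.translate (h : Heads s j ω) {δ : K} (hδ : proj δ = 0) :
    Heads s j (ω.1, ω.2 + δ) := by
  refine ⟨h.1, ?_⟩
  have := h.2
  simp only [proj_sub, proj_add, hδ, add_zero] at this ⊢
  exact this

theorem bounce_translate (δ : K) :
    bounce s j (ω.1, ω.2 + δ) = ((bounce s j ω).1, (bounce s j ω).2 + -δ) := by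
  ext <;> simp [bounce]; ring

/-- A half turn reverses the line on which displacements are measured, hence the sign; the dynamics
is invertible, so returns pass in both directions. -/
theorem ret_bounce (hs : Admissible s) (hj : Heads s j ω) {δ : K} :
    Ret s (bounce s j ω) (-δ) ↔ Ret s ω δ := by
  constructor
  · rintro ⟨n, hn, p, hδ⟩
    have hδ : proj δ = 0 := by simpa using hδ
    obtain ⟨n, rfl⟩ := Nat.exists_eq_succ_of_ne_zero hn.ne'
    obtain ⟨ζ, i, h1, h2, h3⟩ := p.exists_snoc
    rw [← bounce_translate] at h3
    rw [← bounce_injective hs (hj.translate hδ) h2 h3] at h1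
    exact ⟨n + 1, hn, .cons j hj h1, hδ⟩
  · rintro ⟨n, hn, p, hδ⟩
    obtain ⟨n, rfl⟩ := Nat.exists_eq_succ_of_ne_zero hn.ne'
    have h1 := (p.tail_of_heads hs hj).snoc (hj.translate hδ)
    rw [bounce_translate] at h1
    exact ⟨n + 1, hn, h1, by simpa using hδ⟩

/-- The trajectory of `ω` closes up exactly after the positive multiples of `d`. -/
def Cyc (s : K × K) (ω : Bool × K) (d : K) : Prop :=
  ∃ ε : K, (ε = 1 ∨ ε = -1) ∧ ∀ δ, Ret s ω δ ↔ ∃ m : ℕ, 0 < m ∧ δ = ε * (m * d)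

/-- A change of orientation `c` is absorbed in the sign `ε` of `Cyc`; the period `d` itself does not
change. -/
theorem cyc_of_ret_neg {s' : K × K} {d c : K} (hc : c = 1 ∨ c = -1)
    (h : ∀ δ, Ret s' η (c * δ) ↔ Ret s ω δ) : Cyc s' η d ↔ Cyc s ω d := by
  have hcc : c * c = 1 := by rcases hc with rfl | rfl <;> ring
  constructor
  · rintro ⟨ε, hε, H⟩
    refine ⟨c * ε, by rcases hc with rfl | rfl <;> rcases hε with rfl | rfl <;> simp, fun δ => ?_⟩
    rw [← h, H]
    refine exists_congr fun m => and_congr_right fun _ => ⟨fun e => ?_, fun e => ?_⟩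
    · linear_combination c * e - δ * hcc
    · linear_combination c * e + ε * (m * d) * hcc
  · rintro ⟨ε, hε, H⟩
    refine ⟨c * ε, by rcases hc with rfl | rfl <;> rcases hε with rfl | rfl <;> simp, fun δ => ?_⟩
    rw [show δ = c * (c * δ) by linear_combination -δ * hcc, h, H]
    refine exists_congr fun m => and_congr_right fun _ => ⟨fun e => ?_, fun e => ?_⟩
    · linear_combination c * e
    · linear_combination c * e + (ε * (m * d) - c * δ) * hcc

theorem cyc_bounce (hs : Admissible s) (hj : Heads s j ω) {d : K} :
    Cyc s (bounce s j ω) d ↔ Cyc s ω d :=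
  cyc_of_ret_neg (c := -1) (.inr rfl) fun δ => by rw [neg_one_mul]; exact ret_bounce hs hj

end basic

/-! ### Lifting paths to `act k s` and descending again -/

section chains
variable {k : Fin 4} {s : K × K} {ω η ζ : Bool × K} {n m : ℕ} {i j : Fin 5} {l : List (Fin 5)}

theorem OuterChain.path (h : OuterChain k s l ω η) : Path (act k s) l.length ω η := by
  induction l generalizing ω with
  | nil => rw [show ω = η from h]; exact .nil _
  | cons j l ih => exact .cons j h.1.1 (ih h.2)

theorem OuterChain.append {l' : List (Fin 5)} (h : OuterChain k s l ω η)
    (h' : OuterChain k s l' η ζ) : OuterChain k s (l ++ l') ω ζ := by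
  induction l generalizing ω with
  | nil => rw [show ω = η from h]; exact h'
  | cons j l ih => exact ⟨h.1, ih h.2⟩

theorem MeetsOuter.rev_bounce (h : MeetsOuter k s j ω) :
    MeetsOuter k s j (rev (bounce (act k s) j ω)) := by
  refine ⟨h.1.rev_bounce, ?_⟩
  rw [show (rev (bounce (act k s) j ω)).2 - center (act k s) j = -(ω.2 - center (act k s) j) by
    simp [rev, bounce]; ring, proj_neg, abs_neg]
  exact h.2

theorem OuterChain.rev (h : OuterChain k s l ω η) :
    OuterChain k s l.reverse (rev η) (rev ω) := by
  induction l generalizing ω with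
  | nil => rw [show ω = η from h]; rfl
  | cons j l ih =>
    rw [List.reverse_cons]
    exact (ih h.2).append ⟨h.1.rev_bounce, by
      change bounce _ _ _ = _
      rw [← bounce_rev_bounce (s := act k s) (j := j) (ω := ω)]
      simp [PentagonBilliard.rev, bounce]⟩

omit [GoldenRing K] in
theorem rev_rev : rev (rev ω) = ω := by ext <;> simp [rev]

/-- In the system of `s`, the chord of `x` runs from side `i` to side `j`. -/
theorem climb (k : Fin 4) (hs : Admissible s) {x : K} (hij : isFwd j = !isFwd i)
    (hxi : |proj (x - center s i)| < proj (width s i))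
    (hxj : |proj (x - center s j)| < proj (width s j)) :
    ∃ l, OuterChain k s l (rev (lift k s i x)) (lift k s j x) := by
  rcases h : isFwd i with _ | _
  · exact ⟨_, climb_fwd k hs h (by simp [hij, h]) hxi hxj⟩
  · have := (climb_fwd k hs (i := j) (by simp [hij, h]) h hxj hxi).rev
    rw [rev_rev] at this
    exact ⟨_, this⟩

/-- The part of side `j` of the system of `act k s` which is a side of the system of `s`. -/
def MeetsInner (k : Fin 4) (s : K × K) (j : Fin 5) (ω : Bool × K) : Prop :=
  isFwd j = ω.1 ∧ |proj (ω.2 - center (act k s) j)| < proj (width s (tau k j))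

theorem tau_tau (k : Fin 4) (j : Fin 5) : tau k (tau k j) = j := by
  revert k j; decide

theorem width_le (hs : Admissible s) (k : Fin 4) (j : Fin 5) :
    proj (width s (tau k j)) ≤ proj (width (act k s) j) := by
  obtain ⟨ha, hb⟩ := hs
  obtain ⟨ha1, ha2⟩ := golden_mul_bounds ha.le
  obtain ⟨hb1, hb2⟩ := golden_mul_bounds hb
  fin_cases k <;> fin_cases j <;> simp [tau_apply, width_act] <;> simp [width] <;> linarith

theorem MeetsInner.heads (hs : Admissible s) (h : MeetsInner k s j ω) : Heads (act k s) j ω :=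
  ⟨h.1, h.2.trans_le (width_le hs k j)⟩

/-- The copy of side `j` inside side `tau k j` is a translate if both are met in the same direction
of flight, and is turned by a half turn otherwise. -/
def liftSign (k : Fin 4) (j : Fin 5) : K := if isFwd (tau k j) = isFwd j then 1 else -1

theorem liftSign_eq (k : Fin 4) (j : Fin 5) : (liftSign k j : K) = 1 ∨ (liftSign k j : K) = -1 := by
  unfold liftSign; split_ifs <;> simp

theorem lift_eq (x : K) : lift k s j x =
    (isFwd (tau k j), center (act k s) (tau k j) + liftSign k j * (x - center s j)) := by
  unfold lift liftSign; split_ifs <;> simp [sub_eq_add_neg]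

theorem liftSign_mul_self : (liftSign k j : K) * liftSign k j = 1 := by
  rcases liftSign_eq (K := K) k j with h | h <;> rw [h] <;> ring

theorem abs_liftSign (x : K) : |proj (liftSign k j * x)| = |proj x| := by
  rcases liftSign_eq (K := K) k j with h | h <;> simp [h]

theorem meetsInner_lift {x : K} (hx : |proj (x - center s j)| < proj (width s j)) :
    MeetsInner k s (tau k j) (lift k s j x) := by
  rw [lift_eq]
  refine ⟨rfl, ?_⟩
  simp only [add_sub_cancel_left]
  rwa [abs_liftSign, tau_tau]

theorem MeetsInner.exists_lift (h : MeetsInner k s j ω) :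
    ∃ x, ω = lift k s (tau k j) x ∧
      |proj (x - center s (tau k j))| < proj (width s (tau k j)) := by
  refine ⟨center s (tau k j) + liftSign k (tau k j) * (ω.2 - center (act k s) j), ?_, ?_⟩
  · rw [lift_eq, tau_tau]
    ext
    · exact h.1.symm
    · simp only [add_sub_cancel_left]
      rw [← mul_assoc, liftSign_mul_self]
      ring
  · rw [add_sub_cancel_left, abs_liftSign]
    exact h.2

theorem lift_add (x δ : K) : lift k s j (x + δ) =
    ((lift k s j x).1, (lift k s j x).2 + liftSign k j * δ) := by
  simp only [lift_eq]
  ext <;> simp; ring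

/-- The half turns about the midpoints of `j` and `tau k j` correspond under `lift`; this is why
`tau` governs the midpoints. -/
theorem bounce_lift (x : K) : bounce (act k s) (tau k j) (lift k s j x) =
    rev (lift k s j (2 * center s j - x)) := by
  simp only [lift_eq]
  ext <;> simp [bounce, rev]; ring

theorem lift_injective {x y : K} (hs : Admissible s)
    (hx : |proj (x - center s i)| < proj (width s i))
    (hy : |proj (y - center s j)| < proj (width s j)) (h : lift k s i x = lift k s j y) :
    i = j ∧ x = y := by
  have h1 := (meetsInner_lift (k := k) hx).heads hs
  rw [h] at h1
  obtain rfl : i = j := (tau k).injective (h1.unique (hs.act k) ((meetsInner_lift hy).heads hs))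
  refine ⟨rfl, ?_⟩
  simp only [lift_eq, Prod.mk.injEq, true_and, add_right_inj] at h
  linear_combination liftSign k i * h - (x - y) * liftSign_mul_self (K := K) (k := k) (j := i)

/-- Flight is deterministic and inner and outer parts are disjoint, so a path that ends at an inner
part cannot stop within a chain of outer parts. -/
theorem OuterChain.absorb (hs : Admissible s) (h : OuterChain k s l ω ζ)
    (hη : MeetsInner k s j η) (p : Path (act k s) m ω η) :
    ∃ m', m = l.length + m' ∧ Path (act k s) m' ζ η := by
  induction l generalizing ω m with
  | nil => exact ⟨m, by simp, by rwa [← show ω = ζ from h]⟩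
  | cons i l ih =>
    obtain ⟨h1, h2⟩ := h
    cases m with
    | zero =>
      cases p
      obtain rfl := h1.1.unique (hs.act k) (hη.heads hs)
      exact absurd hη.2 (not_lt.2 h1.2)
    | succ m =>
      obtain ⟨m', rfl, h4⟩ := ih h2 (p.tail_of_heads (hs.act k) h1.1)
      exact ⟨m', by simp; ring, h4⟩

/-- Paths which only meet inner parts of sides. -/
inductive InnerPath (k : Fin 4) (s : K × K) : ℕ → Bool × K → Bool × K → Prop
  | nil (ω : Bool × K) : InnerPath k s 0 ω ω
  | cons {n : ℕ} {ω η : Bool × K} (j : Fin 5) (h : MeetsInner k s j ω)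
      (p : InnerPath k s n (bounce (act k s) j ω) η) : InnerPath k s (n + 1) ω η

/-- A chord costs one bounce in the system of `s`, and one bounce plus the length of its chain in
that of `act k s`. Descending saves bounces unless all chains are empty, and then only inner parts
are met. This alternative drives the descent in `exists_treeWord`. -/
theorem descend (hs : Admissible s) {x y : K} (hn : 0 < n)
    (hx : |proj (x - center s i)| < proj (width s i))
    (hy : |proj (y - center s j)| < proj (width s j))
    (p : Path (act k s) n (lift k s i x) (lift k s j y)) :
    ∃ n', 0 < n' ∧ Path s n' (isFwd i, x) (isFwd j, y) ∧
      (n' < n ∨ n' = n ∧ InnerPath k s n (lift k s i x) (lift k s j y)) := by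
  induction n using Nat.strong_induction_on generalizing i x with
  | _ n ih =>
  obtain ⟨n, rfl⟩ := Nat.exists_eq_succ_of_ne_zero hn.ne'
  have hin := meetsInner_lift (k := k) hx
  have p' := p.tail_of_heads (hs.act k) (hin.heads hs)
  rw [bounce_lift] at p'
  have hx1 : |proj (2 * center s i - x - center s i)| < proj (width s i) := by
    rwa [show 2 * center s i - x - center s i = -(x - center s i) by ring, proj_neg, abs_neg]
  have hy' := meetsInner_lift (k := k) hy
  have hb : ∀ {m} {η}, Path s m (!isFwd i, 2 * center s i - x) η → Path s (m + 1) (isFwd i, x) η :=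
    fun q => .cons i ⟨rfl, hx⟩ q
  rcases heads_or_dead hs hx1 with ⟨i', hi'⟩ | hd
  · obtain ⟨l, hl⟩ := climb k hs hi'.1 hx1 hi'.2
    obtain ⟨m', rfl, h4⟩ := hl.absorb hs hy' p'
    have hfwd : (!isFwd i) = isFwd i' := hi'.1.symm
    rw [hfwd] at hb
    rcases Nat.eq_zero_or_pos m' with rfl | hm'
    · have he : lift k s i' (2 * center s i - x) = lift k s j y := h4.eq_of_zero
      obtain ⟨rfl, rfl⟩ := lift_injective hs hi'.2 hy he
      refine ⟨1, one_pos, hb (.nil _), ?_⟩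
      rcases Nat.eq_zero_or_pos l.length with h0 | h0
      · refine .inr ⟨by omega, ?_⟩
        rw [h0]
        refine .cons _ hin ?_
        rw [bounce_lift]
        obtain rfl := List.length_eq_zero_iff.1 h0
        rw [show rev _ = lift _ _ _ _ from hl]
        exact .nil _
      · exact .inl (by omega)
    · obtain ⟨n', h5, h6, h7⟩ := ih m' (by omega) hm' hi'.2 h4
      refine ⟨n' + 1, by omega, hb h6, ?_⟩
      rcases h7 with h7 | ⟨rfl, h7⟩
      · exact .inl (by omega)
      rcases Nat.eq_zero_or_pos l.length with h0 | h0
      · refine .inr ⟨by omega, ?_⟩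
        rw [h0, zero_add]
        refine .cons _ hin ?_
        rw [bounce_lift]
        obtain rfl := List.length_eq_zero_iff.1 h0
        rwa [show rev _ = lift _ _ _ _ from hl]
      · exact .inl (by omega)
  -- A corner below would end the trajectory above as well, but the given path still has a side to
  -- meet.
  · obtain ⟨η, h1, h2⟩ := corner_chain k hs hx1 hd
    obtain ⟨m', rfl, h4⟩ := h1.absorb hs hy' p'
    obtain ⟨j', h⟩ := h4.exists_heads (hy'.heads hs)
    exact absurd h (h2.not_heads (hs.act k))

theorem ascend (hs : Admissible s) {x y : K}
    (hx : |proj (x - center s i)| < proj (width s i))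
    (hy : |proj (y - center s j)| < proj (width s j))
    (p : Path s n (isFwd i, x) (isFwd j, y)) :
    ∃ m, n ≤ m ∧ Path (act k s) m (lift k s i x) (lift k s j y) := by
  induction n generalizing i x with
  | zero =>
    have he : (isFwd i, x) = (isFwd j, y) := p.eq_of_zero
    simp only [Prod.mk.injEq] at he
    obtain ⟨h1, rfl⟩ := he
    obtain rfl := Heads.unique hs (ω := (isFwd i, x)) ⟨rfl, hx⟩ ⟨h1.symm, hy⟩
    exact ⟨0, le_rfl, .nil _⟩
  | succ n ih =>
    have p' := p.tail_of_heads hs (j := i) ⟨rfl, hx⟩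
    have hx1 : |proj (2 * center s i - x - center s i)| < proj (width s i) := by
      rwa [show 2 * center s i - x - center s i = -(x - center s i) by ring, proj_neg, abs_neg]
    obtain ⟨i', hi'⟩ : ∃ i', Heads s i' (!isFwd i, 2 * center s i - x) :=
      p'.exists_heads ⟨rfl, hy⟩
    obtain ⟨l, hl⟩ := climb k hs hi'.1 hx1 hi'.2
    change Path s n (!isFwd i, 2 * center s i - x) _ at p'
    rw [← show isFwd i' = !isFwd i from hi'.1] at p'
    obtain ⟨m, h1, h2⟩ := ih hi'.2 p'
    refine ⟨l.length + m + 1, by omega, .cons _ ((meetsInner_lift hx).heads hs) ?_⟩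
    rw [bounce_lift]
    exact hl.path.trans h2

theorem ret_lift (hs : Admissible s) {x : K} (hx : |proj (x - center s j)| < proj (width s j))
    {δ : K} : Ret (act k s) (lift k s j x) (liftSign k j * δ) ↔ Ret s (isFwd j, x) δ := by
  have hδ : proj (liftSign k j * δ) = 0 ↔ proj δ = 0 := by
    rw [← abs_eq_zero, abs_liftSign, abs_eq_zero]
  have hx' : proj δ = 0 → |proj (x + δ - center s j)| < proj (width s j) := by
    intro h; simpa [h] using hx
  constructor
  · rintro ⟨n, hn, p, h⟩
    rw [hδ] at h
    rw [← lift_add] at p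
    obtain ⟨n', h1, h2, -⟩ := descend hs hn hx (hx' h) p
    exact ⟨n', h1, h2, h⟩
  · rintro ⟨n, hn, p, h⟩
    obtain ⟨m, h1, h2⟩ := ascend (k := k) hs hx (hx' h) p
    rw [lift_add] at h2
    exact ⟨m, by omega, h2, hδ.2 h⟩

theorem cyc_lift (hs : Admissible s) {x : K} (hx : |proj (x - center s j)| < proj (width s j))
    {d : K} : Cyc (act k s) (lift k s j x) d ↔ Cyc s (isFwd j, x) d :=
  cyc_of_ret_neg (liftSign_eq k j) fun _ => ret_lift hs hx

end chains

end PentagonBilliard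

/-! ### Renormalization of closed and of singular trajectories -/

namespace PentagonBilliard
open Real
variable {K : Type*} [GoldenRing K]

section renormalization
variable {k : Fin 4} {s : K × K} {ω η : Bool × K} {n : ℕ} {i j : Fin 5}

theorem heads_or_meetsOuter (h : Heads (act k s) j ω) :
    MeetsInner k s j ω ∨ MeetsOuter k s j ω := by
  rcases lt_or_ge |proj (ω.2 - center (act k s) j)| (proj (width s (tau k j))) with h' | h'
  · exact .inl ⟨h.1, h'⟩
  · exact .inr ⟨h, h'⟩

/-- A trajectory which never ends meets the inner part of a side. -/
theorem exists_meetsInner (hs : Admissible s) {C : Bool × K → Prop}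
    (h1 : ∀ ω, C ω → ∃ j, Heads (act k s) j ω)
    (h2 : ∀ ω j, C ω → Heads (act k s) j ω → C (bounce (act k s) j ω)) (hω : C ω) :
    ∃ η j, C η ∧ MeetsInner k s j η := by
  have key : ∀ ω, C ω → ω.1 = false → ∃ η j, C η ∧ MeetsInner k s j η := by
    intro ω hω hf
    obtain ⟨j, hj⟩ := h1 ω hω
    rcases heads_or_meetsOuter hj with h | hj'
    · exact ⟨_, _, hω, h⟩
    have c1 := h2 _ _ hω hj
    obtain ⟨j1, hj1⟩ := h1 _ c1
    rcases heads_or_meetsOuter hj1 with h | hj1'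
    · exact ⟨_, _, c1, h⟩
    have c2 := h2 _ _ c1 hj1
    obtain ⟨j2, hj2⟩ := h1 _ c2
    rcases heads_or_meetsOuter hj2 with h | hj2'
    · exact ⟨_, _, c2, h⟩
    obtain rfl := hj'.eq_three hf
    obtain rfl := hj2'.eq_three (by simp [bounce, hf])
    rw [show ω = (false, ω.2) by rw [← hf]] at hj' hj1' hj2'
    exact (not_meetsOuter_three hs hj' hj1' hj2').elim
  rcases h : ω.1 with _ | _
  · exact key ω hω h
  · obtain ⟨j, hj⟩ := h1 ω hω
    exact key _ (h2 _ _ hω hj) (by simp [bounce, h])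

theorem Ret.exists_heads {δ : K} (h : Ret s ω δ) : ∃ j, Heads s j ω := by
  obtain ⟨n, hn, p, -⟩ := h
  generalize (ω.1, ω.2 + δ) = η at p
  cases p with
  | nil => simp at hn
  | cons j h _ => exact ⟨j, h⟩

/-- A closed trajectory never ends, hence meets an inner part, where it is a lift; periods change
neither along a trajectory nor under `lift`. -/
theorem exists_cyc (hs : Admissible s) {D : Set K}
    (h : ∀ ω δ, Ret s ω δ → ∃ d ∈ D, Cyc s ω d) (ω : Bool × K) (δ : K)
    (hω : Ret (act k s) ω δ) : ∃ d ∈ D, Cyc (act k s) ω d := by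
  obtain ⟨η, j, ⟨⟨δ', hδ'⟩, h2⟩, hj⟩ := exists_meetsInner (k := k) hs (ω := ω)
    (C := fun η => (∃ δ, Ret (act k s) η δ) ∧ ∀ d, Cyc (act k s) η d → Cyc (act k s) ω d)
    (fun η ⟨⟨δ, h⟩, _⟩ => h.exists_heads)
    (fun η j ⟨⟨δ, h⟩, h'⟩ hj => ⟨⟨-δ, (ret_bounce (hs.act k) hj).2 h⟩,
      fun d hd => h' d ((cyc_bounce (hs.act k) hj).1 hd)⟩)
    ⟨⟨δ, hω⟩, fun _ h => h⟩
  obtain ⟨x, rfl, hx⟩ := hj.exists_lift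
  rw [show δ' = liftSign k (tau k j) * (liftSign k (tau k j) * δ') by
    rw [← mul_assoc, liftSign_mul_self, one_mul], ret_lift hs hx] at hδ'
  obtain ⟨d, hd, hc⟩ := h _ _ hδ'
  exact ⟨d, hd, h2 d ((cyc_lift hs hx).2 hc)⟩

/-- The trajectory runs into a corner. -/
def Dies (s : K × K) (ω : Bool × K) : Prop := ∃ n η, Path s n ω η ∧ Dead s η

theorem Dies.of_path {m : ℕ} (p : Path s m ω η) (h : Dies s η) : Dies s ω := by
  obtain ⟨n, ζ, q, hd⟩ := h
  exact ⟨_, ζ, p.trans q, hd⟩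

theorem Dead.dies (h : Dead s ω) : Dies s ω := ⟨0, ω, .nil _, h⟩

theorem Dies.lift (hs : Admissible s) {x : K} (hx : |proj (x - center s i)| < proj (width s i))
    (h : Dies s (!isFwd i, x)) : Dies (act k s) (rev (lift k s i x)) := by
  obtain ⟨n, η, p, hd⟩ := h
  induction n generalizing i x with
  | zero =>
    rw [← p.eq_of_zero] at hd
    obtain ⟨ζ, h1, h2⟩ := corner_chain k hs hx hd
    exact h2.dies.of_path h1.path
  | succ n ih =>
    obtain ⟨j, hj⟩ : ∃ j, Heads s j (!isFwd i, x) := by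
      cases p with
      | cons j h _ => exact ⟨j, h⟩
    have p' := p.tail_of_heads hs hj
    obtain ⟨l, hl⟩ := climb k hs hj.1 hx hj.2
    have hx1 : |proj (2 * center s j - x - center s j)| < proj (width s j) := by
      rw [show 2 * center s j - x - center s j = -(x - center s j) by ring, proj_neg, abs_neg]
      exact hj.2
    refine .of_path (hl.path.snoc ((meetsInner_lift hj.2).heads hs)) ?_
    rw [bounce_lift]
    refine ih hx1 ?_
    rwa [show ((!isFwd j, 2 * center s j - x) : Bool × K) = bounce s j (!isFwd i, x) by
      simp [bounce, ← show isFwd j = !isFwd i from hj.1]]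

theorem lift_center : lift k s j (center s j) = (isFwd (tau k j), center (act k s) (tau k j)) := by
  rw [lift_eq]; simp

theorem width_nonneg (hs : Admissible s) (j : Fin 5) : 0 ≤ proj (width s j) := by
  obtain ⟨ha, hb⟩ := hs
  have := goldenRatio_pos
  fin_cases j <;> simp [width] <;> positivity

theorem eq_zero_of_width (hs : Admissible s) (h : proj (width s j) = 0) :
    j = 0 ∧ proj s.2 = 0 := by
  obtain ⟨ha, hb⟩ := hs
  have := mul_pos goldenRatio_pos ha
  have := mul_nonneg goldenRatio_pos.le hb
  fin_cases j <;> simp [width] at h ⊢ <;> linarith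

/-- The half turn about a midpoint fixes it, so the velocity pointing out of the side reduces to the
opposite one, and for that one the chords of the smaller system are lifted. -/
theorem dies_center_act (hs : Admissible s) (J : Fin 5)
    (h : ∀ e, Dies s (e, center s (tau k J))) (e : Bool) :
    Dies (act k s) (e, center (act k s) J) := by
  obtain ⟨j, rfl⟩ := (tau k).surjective J
  rw [tau_tau] at h
  have ha := hs.1
  have ha1 := (golden_mul_bounds ha.le).1
  have h1 : Dies (act k s) (!isFwd (tau k j), center (act k s) (tau k j)) := by
    rcases (width_nonneg hs j).lt_or_eq with hw | hw
    · have := (h (!isFwd j)).lift (k := k) hs (by simpa using hw)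
      rwa [lift_center] at this
    -- Side 0 is seen edge-on and has no interior to lift; the line through the midpoint of `tau k
    -- 0` then leads straight to an end of side 3 or 4.
    · obtain ⟨rfl, h0⟩ := eq_zero_of_width hs hw.symm
      refine Dead.dies ?_
      fin_cases k
      · exact .intro 4 rfl (by simp [width_act, h0]; linarith)
          (.inr (by simp [center_act, width_act, h0, tau_apply]))
      · exact .intro 3 rfl (by simp [width_act, h0]; linarith)
          (.inl (by simp [center_act, width_act, h0, tau_apply]; ring))
      · exact .intro 4 rfl (by simp [width_act, h0]; linarith)
          (.inl (by simp [center_act, width_act, h0, tau_apply]; ring))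
      · exact .intro 3 rfl (by simp [width_act, h0]; linarith)
          (.inr (by simp [center_act, width_act, h0, tau_apply]; ring))
  have h2 : Dies (act k s) (isFwd (tau k j), center (act k s) (tau k j)) := by
    rcases (width_nonneg (hs.act k) (tau k j)).lt_or_eq with hw | hw
    · have hh : Heads (act k s) (tau k j) (isFwd (tau k j), center (act k s) (tau k j)) :=
        ⟨rfl, by simpa using hw⟩
      refine .of_path (.cons _ hh (.nil _)) ?_
      rwa [show bounce (act k s) (tau k j) (isFwd (tau k j), center (act k s) (tau k j)) =
        (!isFwd (tau k j), center (act k s) (tau k j)) by ext <;> simp [bounce]; ring]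
    · obtain ⟨h3, h0⟩ := eq_zero_of_width (hs.act k) hw.symm
      rw [h3]
      exact Dead.dies (.intro 3 rfl
        (by have := mul_pos goldenRatio_pos (hs.act k).1; simp [width, h0]; linarith [(hs.act k).1])
        (.inr (by simp [center, width, h0])))
  rcases e.eq_or_eq_not (isFwd (tau k j)) with rfl | rfl
  · exact h2
  · exact h1

theorem cyc_center (hs : Admissible s) (hw : 0 < proj (width s j)) {d : K} :
    Cyc s (!isFwd j, center s j) d ↔ Cyc s (isFwd j, center s j) d := by
  rw [← cyc_bounce hs (j := j) (ω := (isFwd j, center s j)) ⟨rfl, by simpa using hw⟩]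
  simp [bounce]
  ring_nf

theorem cyc_center_act (hs : Admissible s) (J : Fin 5) {d : K}
    (h : ∀ e, Cyc s (e, center s (tau k J)) d) (hw : 0 < proj (width s (tau k J))) (e : Bool) :
    Cyc (act k s) (e, center (act k s) J) d := by
  obtain ⟨j, rfl⟩ := (tau k).surjective J
  rw [tau_tau] at h hw
  have h1 : Cyc (act k s) (isFwd (tau k j), center (act k s) (tau k j)) d := by
    rw [← lift_center, cyc_lift hs (by simpa using hw)]
    exact h _
  rcases e.eq_or_eq_not (isFwd (tau k j)) with rfl | rfl
  · exact h1
  · refine (cyc_center (hs.act k) ?_).2 h1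
    refine hw.trans_le ?_
    have := width_le hs k (tau k j)
    rwa [tau_tau] at this

end renormalization

/-! ### The horizontal direction -/

section horizontal
variable {s : K × K} {ω η : Bool × K} {n : ℕ} {i j : Fin 5}

/-- The two sides bound a cylinder in which the ball shuttles between them; the two half turns
compose to the translation by `2 * (center s j - center s i)`. -/
theorem ret_of_twin (hs : Admissible s) (hij : isFwd j = !isFwd i)
    (hc : proj (center s j) = proj (center s i)) (hw : proj (width s j) = proj (width s i))
    (hω : Heads s i ω) (δ : K) :
    Ret s ω δ ↔ ∃ m : ℕ, 0 < m ∧ δ = 1 * (m * (2 * (center s j - center s i))) := by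
  have hj : Heads s j (bounce s i ω) := by
    refine ⟨by rw [hij, hω.1]; rfl, ?_⟩
    have := hω.rev_bounce.2
    simp only [rev, proj_sub, hc, hw] at this ⊢
    exact this
  have hb : bounce s j (bounce s i ω) = (ω.1, ω.2 + 2 * (center s j - center s i)) := by
    ext <;> simp [bounce]; ring
  have hD : proj (2 * (center s j - center s i)) = 0 := by simp [hc]
  constructor
  · rintro ⟨n, hn, p, hδ⟩
    clear hδ
    induction n using Nat.strong_induction_on generalizing ω δ with
    | _ n ih =>
    obtain ⟨n, rfl⟩ := Nat.exists_eq_succ_of_ne_zero hn.ne'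
    have p := p.tail_of_heads hs hω
    rcases n with _ | n
    · have := congrArg Prod.fst p.eq_of_zero
      simp [bounce] at this
    have p := p.tail_of_heads hs hj
    rw [hb] at p
    rcases n with _ | n
    · have := congrArg Prod.snd p.eq_of_zero
      exact ⟨1, one_pos, by simp at this ⊢; exact this.symm⟩
    · obtain ⟨m, h1, h2⟩ := ih (n + 1) (by omega) (hω.translate hD)
        (δ - 2 * (center s j - center s i))
        (by
          refine ⟨by rw [hij, hω.1]; rfl, ?_⟩
          have := hj.2
          simp only [bounce, proj_sub, proj_add, hD, add_zero] at this ⊢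
          exact this)
        (by ext <;> simp [bounce]; ring) (by omega)
        (by
          rw [show ω.2 + 2 * (center s j - center s i) + (δ - 2 * (center s j - center s i)) =
            ω.2 + δ by ring]
          exact p)
      exact ⟨m + 1, by omega, by push_cast; linear_combination h2⟩
  · rintro ⟨m, hm, rfl⟩
    refine ⟨2 * m, by omega, ?_, by simp [hc]⟩
    clear hm
    induction m generalizing ω with
    | zero => simp; exact .nil _
    | succ m ih =>
      have := ih (hω.translate hD)
        (by
          refine ⟨by rw [hij, hω.1]; rfl, ?_⟩
          have := hj.2
          simp only [bounce, proj_sub, proj_add, hD, add_zero] at this ⊢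
          exact this)
        (by ext <;> simp [bounce]; ring)
      rw [← hb] at this
      convert Path.cons i hω (Path.cons j hj this) using 2
      · rfl
      · rw [hb]
      · rw [hb]; push_cast; ring

/-- The side which is parallel to the horizontal flow through side `j`. -/
def twin : Fin 5 → Fin 5 := ![0, 2, 1, 4, 3]

theorem twin_spec (h0 : proj s.2 = 0) (hj : j ≠ 0) : isFwd (twin j) = !isFwd j ∧
    proj (center s (twin j)) = proj (center s j) ∧ proj (width s (twin j)) = proj (width s j) := by
  fin_cases j <;> simp [twin, isFwd, center, width, h0] at hj ⊢

/-- The centres of sides 1 and 2 differ by `g * s.2`, those of 3 and 4 by `(g + 1) * s.2 = g ^ 2 *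
s.2`. These differences vanish under `proj` but survive in `K`, where they carry the periods. -/
theorem cyc_horizontal (hs : Admissible s) (h0 : proj s.2 = 0) (hω : Heads s j ω) :
    ((j = 1 ∨ j = 2) ∧ Cyc s ω (2 * (g * s.2))) ∨
      ((j = 3 ∨ j = 4) ∧ Cyc s ω (2 * (g ^ 2 * s.2))) := by
  have hj : j ≠ 0 := by
    rintro rfl
    have := hω.2
    simp [width, h0] at this
    exact absurd this (not_lt.2 (abs_nonneg _))
  obtain ⟨h1, h2, h3⟩ := twin_spec h0 hj
  have key := ret_of_twin hs h1 h2 h3 hω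
  have mk : ∀ (ε d : K), (ε = 1 ∨ ε = -1) → 2 * (center s (twin j) - center s j) = ε * d →
      Cyc s ω d := fun ε d hε h => ⟨ε, hε, fun δ => by
    rw [key, h]
    refine exists_congr fun m => and_congr_right fun _ => ?_
    rw [show (1 : K) * (m * (ε * d)) = ε * (m * d) by ring]⟩
  fin_cases j
  · exact absurd rfl hj
  · exact .inl ⟨.inl rfl, mk (-1) _ (.inr rfl) (by simp [twin, center]; ring)⟩
  · exact .inl ⟨.inr rfl, mk 1 _ (.inl rfl) (by simp [twin, center]; ring)⟩
  · exact .inr ⟨.inl rfl, mk (-1) _ (.inr rfl) (by simp [twin, center, g_sq]; ring)⟩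
  · exact .inr ⟨.inr rfl, mk 1 _ (.inl rfl) (by simp [twin, center, g_sq]; ring)⟩

theorem dies_horizontal (hs : Admissible s) (h0 : proj s.2 = 0) (e : Bool) :
    Dies s (e, center s 0) := by
  have := mul_pos goldenRatio_pos hs.1
  rcases e with _ | _
  · exact Dead.dies (.intro 3 rfl (by simpa [width, h0] using this)
      (.inr (by simp [center, width, h0])))
  · exact Dead.dies (.intro 4 rfl (by simpa [width, h0] using this)
      (.inr (by simp [center, width, h0])))

end horizontal

end PentagonBilliard

/-! ### Tree words -/

namespace PentagonBilliard
open Real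

section words

theorem wordVector_append (a : List (Fin 4)) (k : Fin 4) :
    wordVector (a ++ [k]) = (sigma k).mulVec (wordVector a) := by
  simp [wordVector, List.foldl_append]

theorem wordPerm_append (a : List (Fin 4)) (k : Fin 4) :
    wordPerm (a ++ [k]) = wordPerm a * tau k := by
  simp [wordPerm]

theorem sigma_mulVec (k : Fin 4) (x : Fin 2 → ℝ) : (sigma k).mulVec x =
    ![![x 0 + goldenRatio * x 1, x 1], ![goldenRatio * x 0 + goldenRatio * x 1,
      x 0 + goldenRatio * x 1], ![goldenRatio * x 0 + x 1, goldenRatio * x 0 + goldenRatio * x 1],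
      ![x 0, goldenRatio * x 0 + x 1]] k := by
  fin_cases k <;> ext i <;> fin_cases i <;> simp [sigma, Matrix.mulVec, dotProduct]

theorem inFirstQuadrant_sigma {x : Fin 2 → ℝ} (hx : InFirstQuadrant x) (k : Fin 4) :
    InFirstQuadrant ((sigma k).mulVec x) := by
  obtain ⟨h0, h1⟩ := hx
  have := goldenRatio_pos
  rw [sigma_mulVec]
  fin_cases k <;> simp [InFirstQuadrant] <;> constructor <;> positivity

theorem inFirstQuadrant_wordVector (a : List (Fin 4)) : InFirstQuadrant (wordVector a) := by
  induction a using List.reverseRecOn with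
  | nil => simp [wordVector, InFirstQuadrant]
  | append_singleton a k ih => rw [wordVector_append]; exact inFirstQuadrant_sigma ih k

/-- The rays of slope `1/φ`, `1`, `φ` cut the quadrant into the four cones of the `σₖ`. Each cone
contains its lower ray but not its upper one, and the witness is `σₖ⁻¹ x`. -/
theorem exists_sigma {x : Fin 2 → ℝ} (hx : InFirstQuadrant x) :
    ∃ k y, InFirstQuadrant y ∧ x = (sigma k).mulVec y := by
  obtain ⟨h0, h1⟩ := hx
  have hφ := goldenRatio_pos
  have hq := goldenRatio_sq
  rcases le_or_gt (goldenRatio * x 1) (x 0) with h | h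
  · rcases h.lt_or_eq with h | h
    · refine ⟨0, ![x 0 - goldenRatio * x 1, x 1], ⟨by simpa using h, by simpa using h1⟩, ?_⟩
      rw [sigma_mulVec]; ext i; fin_cases i <;> simp
    · have : 0 < x 1 := pos_of_mul_pos_right (h ▸ h0) hφ.le
      refine ⟨1, ![goldenRatio * x 0 - goldenRatio * x 1, goldenRatio * x 1 - x 0],
        ⟨?_, by simp [h]⟩, ?_⟩
      · simp; nlinarith [one_lt_goldenRatio]
      · rw [sigma_mulVec]; ext i
        fin_cases i <;> simp
        · linear_combination -(x 0) * hq
        · linear_combination -(x 1) * hq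
  rcases lt_or_ge (x 1) (x 0) with h' | h'
  · refine ⟨1, ![goldenRatio * x 0 - goldenRatio * x 1, goldenRatio * x 1 - x 0],
      ⟨by simp; nlinarith, by simp; linarith⟩, ?_⟩
    rw [sigma_mulVec]; ext i
    fin_cases i <;> simp
    · linear_combination -(x 0) * hq
    · linear_combination -(x 1) * hq
  rcases lt_or_ge (x 1) (goldenRatio * x 0) with h'' | h''
  · refine ⟨2, ![goldenRatio * x 0 - x 1, goldenRatio * x 1 - goldenRatio * x 0],
      ⟨by simpa using h'', by simp; nlinarith⟩, ?_⟩
    rw [sigma_mulVec]; ext i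
    fin_cases i <;> simp
    · linear_combination -(x 0) * hq
    · linear_combination -(x 1) * hq
  · refine ⟨3, ![x 0, x 1 - goldenRatio * x 0], ⟨by simpa using h0, by simpa using h''⟩, ?_⟩
    rw [sigma_mulVec]; ext i
    fin_cases i <;> simp

/-- The images of the first quadrant under the `σₖ` are disjoint. -/
theorem sigma_disjoint {k k' : Fin 4} {x y : Fin 2 → ℝ} {l : ℝ} (hl : 0 < l)
    (hx : InFirstQuadrant x) (hy : InFirstQuadrant y)
    (h : (sigma k).mulVec x = l • (sigma k').mulVec y) : k = k' ∧ x = l • y := by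
  have hφ := goldenRatio_pos
  have hq := goldenRatio_sq
  obtain ⟨hx0, hx1⟩ := hx
  obtain ⟨hy0, hy1⟩ := id hy
  obtain ⟨z, rfl⟩ : ∃ z, y = l⁻¹ • z := ⟨l • y, by simp [hl.ne']⟩
  rw [Matrix.mulVec_smul, smul_smul, mul_inv_cancel₀ hl.ne', one_smul] at h
  rw [smul_smul, mul_inv_cancel₀ hl.ne', one_smul]
  have hz0 : 0 < z 0 := by
    have := mul_pos hl hy0; simpa [hl.ne'] using this
  have hz1 : 0 ≤ z 1 := by
    have := mul_nonneg hl.le hy1; simpa [hl.ne'] using this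
  rw [sigma_mulVec, sigma_mulVec] at h
  have e0 := congrFun h 0
  have e1 := congrFun h 1
  have p0 := mul_pos hφ hx0
  have p1 := mul_nonneg hφ.le hx1
  have p2 := mul_pos hφ hz0
  have p3 := mul_nonneg hφ.le hz1
  have q0 : goldenRatio * (goldenRatio * x 0) = goldenRatio * x 0 + x 0 := by
    linear_combination x 0 * hq
  have q1 : goldenRatio * (goldenRatio * x 1) = goldenRatio * x 1 + x 1 := by
    linear_combination x 1 * hq
  have q2 : goldenRatio * (goldenRatio * z 0) = goldenRatio * z 0 + z 0 := by
    linear_combination z 0 * hq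
  have q3 : goldenRatio * (goldenRatio * z 1) = goldenRatio * z 1 + z 1 := by
    linear_combination z 1 * hq
  have f0 := congrArg (goldenRatio * ·) e0
  have f1 := congrArg (goldenRatio * ·) e1
  clear h
  fin_cases k <;> fin_cases k' <;> simp [mul_add] at e0 e1 f0 f1 ⊢ <;> first
    | (exfalso; linarith)
    | (ext i; fin_cases i <;> simp <;> first
        | linarith
        | linear_combination e0 - goldenRatio * e1
        | linear_combination e1 - goldenRatio * e0)

/-- A letter other than 0 moves `(1, 0)` off the horizontal axis, and no letter leads back to it. -/
theorem wordVector_snd_pos {a : List (Fin 4)} (ha : a ≠ []) (h : a.head? ≠ some 0) :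
    0 < wordVector a 1 := by
  induction a using List.reverseRecOn with
  | nil => exact absurd rfl ha
  | append_singleton a k ih =>
    obtain ⟨h0, h1⟩ := inFirstQuadrant_wordVector a
    rw [wordVector_append, sigma_mulVec]
    have := goldenRatio_pos
    rcases eq_or_ne a [] with rfl | ha'
    · fin_cases k <;> simp at h ⊢ <;> positivity
    · have h2 := ih ha' (by cases a <;> simp_all)
      fin_cases k <;> simp <;> positivity

theorem wordVector_injective {a b : List (Fin 4)} (ha : a.head? ≠ some 0) (hb : b.head? ≠ some 0)
    {l : ℝ} (hl : 0 < l) (h : wordVector a = l • wordVector b) : a = b := by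
  induction a using List.reverseRecOn generalizing b with
  | nil =>
    by_contra hne
    have := wordVector_snd_pos (Ne.symm hne) hb
    have h1 := congrFun h 1
    rw [Pi.smul_apply, smul_eq_mul, show wordVector [] 1 = 0 by simp [wordVector]] at h1
    linarith [mul_pos hl this]
  | append_singleton a k ih =>
    rcases List.eq_nil_or_concat b with rfl | ⟨b, k', rfl⟩
    · have := wordVector_snd_pos (by simp) ha
      rw [h] at this
      simp [wordVector] at this
    · rw [List.concat_eq_append] at *
      rw [wordVector_append, wordVector_append] at h
      obtain ⟨rfl, h1⟩ := sigma_disjoint hl (inFirstQuadrant_wordVector a)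
        (inFirstQuadrant_wordVector b) h
      have aux : ∀ c : List (Fin 4), (c ++ [k]).head? ≠ some 0 → c.head? ≠ some 0 := by
        intro c hc
        cases c <;> simp at hc ⊢
        exact hc
      rw [ih (aux a ha) (aux b hb) h1]

theorem IsTreeWord.unique {a b : List (Fin 4)} {x : Fin 2 → ℝ} (ha : a.head? ≠ some 0)
    (hb : b.head? ≠ some 0) (hax : IsTreeWord a x) (hbx : IsTreeWord b x) : a = b := by
  obtain ⟨l, hl, rfl⟩ := hax
  obtain ⟨m, hm, h⟩ := hbx
  refine wordVector_injective ha hb (l := l⁻¹ * m) (by positivity) ?_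
  rw [mul_smul, ← h, smul_smul, inv_mul_cancel₀ hl.ne', one_smul]

/-- `σ₀` fixes `(1, 0)`, so leading zeros can be dropped. -/
theorem IsTreeWord.exists_reduced {a : List (Fin 4)} {x : Fin 2 → ℝ} (h : IsTreeWord a x) :
    ∃ b : List (Fin 4), b.head? ≠ some 0 ∧ IsTreeWord b x := by
  induction a with
  | nil => exact ⟨[], by simp, h⟩
  | cons k a ih =>
    rcases eq_or_ne k 0 with rfl | hk
    · refine ih ?_
      obtain ⟨l, hl, rfl⟩ := h
      refine ⟨l, hl, ?_⟩
      rw [wordVector, List.foldl_cons, show (sigma 0).mulVec ![1, 0] = ![1, 0] by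
        rw [sigma_mulVec]; simp, wordVector]
    · exact ⟨k :: a, by simpa using hk, h⟩

theorem IsTreeWord.snoc {a : List (Fin 4)} {x : Fin 2 → ℝ} (h : IsTreeWord a x) (k : Fin 4) :
    IsTreeWord (a ++ [k]) ((sigma k).mulVec x) := by
  obtain ⟨l, hl, rfl⟩ := h
  exact ⟨l, hl, by rw [wordVector_append, Matrix.mulVec_smul]⟩

end words

end PentagonBilliard

/-! ### Classification along a tree word, and its existence -/

namespace PentagonBilliard
open Real
variable {K : Type*} [GoldenRing K]

/-- The direction of flight of a system. -/
def direction (s : K × K) : Fin 2 → ℝ := ![proj s.1, proj s.2]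

theorem admissible_iff {s : K × K} : Admissible s ↔ InFirstQuadrant (direction s) := by
  simp [Admissible, InFirstQuadrant, direction]

theorem direction_act (k : Fin 4) (s : K × K) :
    direction (act k s) = (sigma k).mulVec (direction s) := by
  rw [sigma_mulVec]
  fin_cases k <;> simp [direction, act]

theorem act_surjective (k : Fin 4) (s : K × K) : ∃ s', act k s' = s := by
  have hg := g_sq (K := K)
  refine ⟨![(s.1 - g * s.2, s.2), (g * s.1 - g * s.2, g * s.2 - s.1),
    (g * s.1 - s.2, g * s.2 - g * s.1), (s.1, s.2 - g * s.1)] k, ?_⟩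
  fin_cases k <;> ext <;> simp [act]
  · linear_combination s.1 * hg
  · linear_combination s.2 * hg
  · linear_combination s.1 * hg
  · linear_combination s.2 * hg

theorem sigma_mulVec_injective (k : Fin 4) : Function.Injective (sigma k).mulVec := by
  have h : (sigma k).det = 1 := by
    have hq := goldenRatio_sq
    fin_cases k <;> simp [sigma, Matrix.det_fin_two] <;> linear_combination hq
  exact Matrix.mulVec_injective_of_isUnit ((Matrix.isUnit_iff_isUnit_det _).2 (by simp [h]))

theorem exists_act_of_direction {k : Fin 4} {s : K × K} {y : Fin 2 → ℝ}
    (h : direction s = (sigma k).mulVec y) : ∃ s', act k s' = s ∧ direction s' = y := by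
  obtain ⟨s', rfl⟩ := act_surjective k s
  rw [direction_act] at h
  exact ⟨s', rfl, sigma_mulVec_injective k h⟩

/-- Only words in the letter 0 stay horizontal, and `τ₀` fixes the label 5, which is 0 in `Fin 5`.
Hence a side seen edge-on is never claimed to be short or long. -/
theorem wordPerm_zero {a : List (Fin 4)} (h : wordVector a 1 = 0) : wordPerm a 0 = 0 := by
  induction a using List.reverseRecOn with
  | nil => rfl
  | append_singleton a k ih =>
    obtain ⟨h0, h1⟩ := inFirstQuadrant_wordVector a
    have := mul_pos goldenRatio_pos h0
    have := mul_nonneg goldenRatio_pos.le h1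
    rw [wordVector_append, sigma_mulVec] at h
    rw [wordPerm_append, Equiv.Perm.mul_apply]
    fin_cases k <;> simp at h
    · exact ih h
    all_goals linarith

/-- The closed trajectories and the trajectories through the midpoints in the direction of a tree
word. -/
theorem classify (f : K →+* ℝ) (hf : f g = goldenRatio) (a : List (Fin 4)) (s : K × K)
    (h : IsTreeWord a (direction s)) :
    ∃ q : K, (f s.1 * proj s.2 - f s.2 * proj s.1 ≠ 0 → f q ≠ 0) ∧
      (∀ ω δ, Ret s ω δ → ∃ d ∈ ({2 * (g * q), 2 * (g ^ 2 * q)} : Set K), Cyc s ω d) ∧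
      ∀ J e, (wordPerm a J ∈ ({1, 2} : Set (Fin 5)) → Cyc s (e, center s J) (2 * (g * q))) ∧
        (wordPerm a J ∈ ({3, 4} : Set (Fin 5)) → Cyc s (e, center s J) (2 * (g ^ 2 * q))) ∧
        (wordPerm a J = 5 → Dies s (e, center s J)) := by
  induction a using List.reverseRecOn generalizing s with
  | nil =>
    obtain ⟨l, hl, h⟩ := h
    have h1 : proj s.1 = l := by simpa [direction, wordVector] using congrFun h 0
    have h0 : proj s.2 = 0 := by simpa [direction, wordVector] using congrFun h 1
    have hs : Admissible s := ⟨h1 ▸ hl, h0.ge⟩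
    -- As `proj s.2 = 0` here, the determinant is `-f s.2 * proj s.1`.
    refine ⟨s.2, fun hd h2 => hd (by simp [h0, h2]), fun ω δ hr => ?_, fun J e => ?_⟩
    · obtain ⟨j, hj⟩ := hr.exists_heads
      rcases cyc_horizontal hs h0 hj with ⟨-, h⟩ | ⟨-, h⟩
      · exact ⟨_, .inl rfl, h⟩
      · exact ⟨_, .inr rfl, h⟩
    · have hw : J ≠ 0 → 0 < proj (width s J) := fun hJ =>
        (width_nonneg hs J).lt_of_ne' fun h => hJ (eq_zero_of_width hs h).1
      have key : ∀ d, J ≠ 0 → Cyc s (isFwd J, center s J) d → Cyc s (e, center s J) d := by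
        intro d hJ h
        rcases e.eq_or_eq_not (isFwd J) with rfl | rfl
        · exact h
        · exact (cyc_center hs (hw hJ)).2 h
      have hh : J ≠ 0 → Heads s J (isFwd J, center s J) := fun hJ => ⟨rfl, by simpa using hw hJ⟩
      simp only [wordPerm, List.map_nil, List.prod_nil, Equiv.Perm.one_apply]
      refine ⟨fun hJ => ?_, fun hJ => ?_, fun hJ => ?_⟩
      · have hJ0 : J ≠ 0 := by rintro rfl; simp at hJ
        rcases cyc_horizontal hs h0 (hh hJ0) with ⟨-, h⟩ | ⟨h', -⟩
        · exact key _ hJ0 h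
        · rcases hJ with rfl | rfl <;> simp at h'
      · have hJ0 : J ≠ 0 := by rintro rfl; simp at hJ
        rcases cyc_horizontal hs h0 (hh hJ0) with ⟨h', -⟩ | ⟨-, h⟩
        · rcases hJ with rfl | rfl <;> simp at h'
        · exact key _ hJ0 h
      · rw [hJ]
        exact dies_horizontal hs h0 e
  | append_singleton a k ih =>
    obtain ⟨l, hl, h⟩ := h
    rw [wordVector_append, ← Matrix.mulVec_smul] at h
    obtain ⟨s', rfl, h'⟩ := exists_act_of_direction h
    have hs : Admissible s' := by
      rw [admissible_iff, h']
      obtain ⟨h0, h1⟩ := inFirstQuadrant_wordVector a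
      exact ⟨mul_pos hl h0, mul_nonneg hl.le h1⟩
    obtain ⟨q, h1, h2, h3⟩ := ih s' ⟨l, hl, h'⟩
    -- The same `q` serves at every level, since `σₖ` has determinant 1 and preserves the
    -- determinant of `f` and `proj`.
    refine ⟨q, fun hd => h1 fun h0 => hd ?_, fun ω δ hr => exists_cyc hs h2 ω δ hr, fun J e => ?_⟩
    · have hq := goldenRatio_sq
      rw [← h0]
      fin_cases k <;> simp [act, hf]
      · ring
      · linear_combination (f s'.1 * proj s'.2 - f s'.2 * proj s'.1) * hq
      · linear_combination (f s'.1 * proj s'.2 - f s'.2 * proj s'.1) * hq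
      · ring
    · rw [wordPerm_append, Equiv.Perm.mul_apply]
      have hw : wordPerm a (tau k J) ≠ 5 → 0 < proj (width s' (tau k J)) := by
        intro hne
        refine (width_nonneg hs _).lt_of_ne' fun hw => hne ?_
        obtain ⟨hJ, hY⟩ := eq_zero_of_width hs hw
        rw [hJ]
        refine wordPerm_zero ?_
        have h1 := congrFun h' 1
        simp [direction, hY] at h1
        exact h1.resolve_left hl.ne'
      refine ⟨fun hJ => cyc_center_act hs J (fun e => (h3 _ e).1 hJ) (hw ?_) e,
        fun hJ => cyc_center_act hs J (fun e => (h3 _ e).2.1 hJ) (hw ?_) e,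
        fun hJ => dies_center_act hs J (fun e => (h3 _ e).2.2 hJ) e⟩ <;>
      · rcases hJ with hJ | hJ <;> rw [hJ] <;> decide

/-- Along a chord which only meets inner parts, the ball drifts in one direction. -/
theorem drift_zero {s : K × K} (hs : Admissible s) (h2 : 0 < proj s.2) {ω : Bool × K} {i j : Fin 5}
    (hi : MeetsInner 0 s i ω) (hj : MeetsInner 0 s j (bounce (act 0 s) i ω)) :
    if ω.1 then proj ω.2 < proj (bounce (act 0 s) j (bounce (act 0 s) i ω)).2
    else proj (bounce (act 0 s) j (bounce (act 0 s) i ω)).2 < proj ω.2 := by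
  obtain ⟨ha, hb⟩ := hs
  obtain ⟨ha1, ha2⟩ := golden_mul_bounds ha.le
  obtain ⟨hb1, hb2⟩ := golden_mul_bounds hb
  obtain ⟨e, x⟩ := ω
  obtain ⟨hi, hi'⟩ := hi
  obtain ⟨hj, hj'⟩ := hj
  simp only [bounce] at hi hj hi' hj' ⊢
  rcases e with _ | _
  · rcases isFwd_eq_false hi with rfl | rfl | rfl <;> rcases isFwd_eq_true hj with rfl | rfl <;>
      clear hi hj <;>
      simp [tau_apply, center_act, abs_lt] at hi' hj' ⊢ <;> simp [width] at hi' hj' <;> linarith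
  · rcases isFwd_eq_true hi with rfl | rfl <;> rcases isFwd_eq_false hj with rfl | rfl | rfl <;>
      clear hi hj <;>
      simp [tau_apply, center_act, abs_lt] at hi' hj' ⊢ <;> simp [width] at hi' hj' <;> linarith

theorem drift_three {s : K × K} (hs : Admissible s) {ω : Bool × K} {i j : Fin 5}
    (hi : MeetsInner 3 s i ω) (hj : MeetsInner 3 s j (bounce (act 3 s) i ω)) :
    if ω.1 then proj (bounce (act 3 s) j (bounce (act 3 s) i ω)).2 < proj ω.2
    else proj ω.2 < proj (bounce (act 3 s) j (bounce (act 3 s) i ω)).2 := by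
  obtain ⟨ha, hb⟩ := hs
  obtain ⟨ha1, ha2⟩ := golden_mul_bounds ha.le
  obtain ⟨hb1, hb2⟩ := golden_mul_bounds hb
  obtain ⟨e, x⟩ := ω
  obtain ⟨hi, hi'⟩ := hi
  obtain ⟨hj, hj'⟩ := hj
  simp only [bounce] at hi hj hi' hj' ⊢
  rcases e with _ | _
  · rcases isFwd_eq_false hi with rfl | rfl | rfl <;> rcases isFwd_eq_true hj with rfl | rfl <;>
      clear hi hj <;>
      simp [tau_apply, center_act, abs_lt] at hi' hj' ⊢ <;> simp [width] at hi' hj' <;> linarith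
  · rcases isFwd_eq_true hi with rfl | rfl <;> rcases isFwd_eq_false hj with rfl | rfl | rfl <;>
      clear hi hj <;>
      simp [tau_apply, center_act, abs_lt] at hi' hj' ⊢ <;> simp [width] at hi' hj' <;> linarith

/-- For `k = 1, 2` every list in `climbSides` is nonempty: no chord joins two inner parts directly.
-/
theorem not_meetsInner_two {k : Fin 4} (hk : k = 1 ∨ k = 2) {s : K × K} (hs : Admissible s)
    {ω : Bool × K} {i j : Fin 5}
    (hi : MeetsInner k s i ω) (hj : MeetsInner k s j (bounce (act k s) i ω)) : False := by
  obtain ⟨ha, hb⟩ := hs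
  obtain ⟨ha1, ha2⟩ := golden_mul_bounds ha.le
  obtain ⟨hb1, hb2⟩ := golden_mul_bounds hb
  obtain ⟨e, x⟩ := ω
  obtain ⟨hi, hi'⟩ := hi
  obtain ⟨hj, hj'⟩ := hj
  simp only [bounce] at hi hj hi' hj' ⊢
  rcases e with _ | _
  · rcases isFwd_eq_false hi with rfl | rfl | rfl <;> rcases isFwd_eq_true hj with rfl | rfl <;>
      clear hi hj <;> rcases hk with rfl | rfl <;>
      simp [tau_apply, center_act, abs_lt] at hi' hj' ⊢ <;> simp [width] at hi' hj' <;> linarith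
  · rcases isFwd_eq_true hi with rfl | rfl <;> rcases isFwd_eq_false hj with rfl | rfl | rfl <;>
      clear hi hj <;> rcases hk with rfl | rfl <;>
      simp [tau_apply, center_act, abs_lt] at hi' hj' ⊢ <;> simp [width] at hi' hj' <;> linarith

/-- Velocities alternate, so positions are compared at every second bounce. `R` will be `<` or `>`,
and the empty relation for `k = 1, 2`. -/
theorem InnerPath.drift {k : Fin 4} {s : K × K} {R : ℝ → ℝ → Prop} (hR : ∀ x y z, R x y → R y z → R x z)
    (e : Bool) (h : ∀ ω i j, ω.1 = e → MeetsInner k s i ω → MeetsInner k s j (bounce (act k s) i ω) →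
      R (proj ω.2) (proj (bounce (act k s) j (bounce (act k s) i ω)).2))
    {n : ℕ} {ω η : Bool × K} (p : InnerPath k s n ω η) (hn : 0 < n) (hω : ω.1 = e) (hη : η.1 = e) :
    R (proj ω.2) (proj η.2) := by
  induction n using Nat.strong_induction_on generalizing ω with
  | _ n ih =>
  cases p with
  | nil => simp at hn
  | cons i hi p =>
    cases p with
    | nil => simp [bounce, hω] at hη
    | cons j hj p =>
      have h1 := h ω i j hω hi hj
      rename_i m
      rcases Nat.eq_zero_or_pos m with rfl | hm
      · cases p; exact h1
      · exact hR _ _ _ h1 (ih m (by omega) p hm (by simp [bounce, hω]))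

/-- `h2` excludes the horizontal direction, in which for `k = 0` the ball may shuttle between inner
parts without drifting. -/
theorem not_innerPath {k : Fin 4} {s : K × K} (hs : Admissible s)
    (h2 : 0 < proj (act k s).2) {n : ℕ} (hn : 0 < n) {ω η : Bool × K} (hωη : ω.1 = η.1)
    (h : proj ω.2 = proj η.2) (p : InnerPath k s n ω η) : False := by
  have hlt : ∀ x y z : ℝ, x < y → y < z → x < z := fun _ _ _ => lt_trans
  have hgt : ∀ x y z : ℝ, x > y → y > z → x > z := fun _ _ _ => gt_trans
  have hk : k = 0 ∨ (k = 1 ∨ k = 2) ∨ k = 3 := (by decide : ∀ k : Fin 4, k = 0 ∨ (k = 1 ∨ k = 2) ∨ k = 3) k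
  rcases hk with rfl | hk | rfl
  · rcases he : ω.1 with _ | _
    · exact (p.drift (R := (· > ·)) hgt false (fun ω i j hω hi hj => by
        simpa [hω] using drift_zero hs (by simpa [act] using h2) hi hj) hn he (hωη ▸ he)).ne' h
    · exact (p.drift (R := (· < ·)) hlt true (fun ω i j hω hi hj => by
        simpa [hω] using drift_zero hs (by simpa [act] using h2) hi hj) hn he (hωη ▸ he)).ne h
  · exact p.drift (R := fun _ _ => False) (fun _ _ _ h _ => h) ω.1
      (fun ω i j _ hi hj => not_meetsInner_two hk hs hi hj) hn rfl hωη.symm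
  · rcases he : ω.1 with _ | _
    · exact (p.drift (R := (· < ·)) hlt false (fun ω i j hω hi hj => by
        simpa [hω] using drift_three hs hi hj) hn he (hωη ▸ he)).ne h
    · exact (p.drift (R := (· > ·)) hgt true (fun ω i j hω hi hj => by
        simpa [hω] using drift_three hs hi hj) hn he (hωη ▸ he)).ne' h

theorem exists_treeWord (n : ℕ) (hn : 0 < n) (s : K × K) (hs : Admissible s) (ω : Bool × K) (δ : K)
    (hδ : proj δ = 0) (p : Path s n ω (ω.1, ω.2 + δ)) : ∃ a, IsTreeWord a (direction s) := by
  induction n using Nat.strong_induction_on generalizing s ω δ with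
  | _ n ih =>
  rcases hs.2.eq_or_lt with h0 | h0
  · exact ⟨[], proj s.1, hs.1, by ext i; fin_cases i <;> simp [direction, wordVector, ← h0]⟩
  obtain ⟨k, y, hy, hk⟩ := exists_sigma (admissible_iff.1 hs)
  obtain ⟨s', rfl, h'⟩ := exists_act_of_direction hk
  have hs' : Admissible s' := by rwa [admissible_iff, h']
  obtain ⟨n, rfl⟩ := Nat.exists_eq_succ_of_ne_zero hn.ne'
  obtain ⟨η, j, ⟨δ', hδ', p'⟩, hj⟩ := exists_meetsInner (k := k) hs' (ω := ω)
    -- The number of bounces is kept fixed while moving along the trajectory to an inner part, so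
    -- that the strict inequality from `descend` feeds the induction.
    (C := fun η => ∃ δ, proj δ = 0 ∧ Path (act k s') (n + 1) η (η.1, η.2 + δ))
    (fun η ⟨δ, hδ, q⟩ => Ret.exists_heads (δ := δ) ⟨n + 1, hn, q, hδ⟩)
    (fun η j ⟨δ, hδ, q⟩ hj => ⟨-δ, by simpa using hδ, by
      rw [← bounce_translate]
      exact (q.tail_of_heads hs hj).snoc (hj.translate hδ)⟩)
    ⟨δ, hδ, p⟩
  obtain ⟨x, rfl, hx⟩ := hj.exists_lift
  have e : δ' = liftSign k (tau k j) * (liftSign k (tau k j) * δ') := by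
    rw [← mul_assoc, liftSign_mul_self, one_mul]
  have hδ'' : proj (liftSign k (tau k j) * δ') = 0 := by simp [hδ']
  rw [e, ← lift_add] at p'
  have hx' : |proj (x + liftSign k (tau k j) * δ' - center s' (tau k j))| <
      proj (width s' (tau k j)) := by
    simpa [hδ'] using hx
  obtain ⟨n', h1, h2, h3⟩ := descend hs' hn hx hx' p'
  rcases h3 with h3 | ⟨-, h3⟩
  · obtain ⟨a, ha⟩ := ih n' h3 h1 s' hs' _ _ hδ'' h2
    refine ⟨a ++ [k], ?_⟩
    rw [direction_act]
    exact ha.snoc k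
  · refine (not_innerPath hs' h0 hn ?_ ?_ h3).elim
    · simp [lift_eq]
    · rw [lift_add]; simp [hδ']

end PentagonBilliard

/-! ### Geometry of the pentagon in golden coordinates -/

namespace PentagonBilliard
open Real

/-- 3 solves `x² = x + 1` modulo 5, so the formulas for the centres also follow the rotations of the
table by multiples of `2π/5`. -/
noncomputable instance : GoldenRing (ℝ × ℝ × ZMod 5) where
  toCommRing := inferInstance
  gen := (goldenRatio, goldenRatio, 3)
  gen_sq := by
    ext
    · simp [goldenRatio_sq]
    · simp [goldenRatio_sq]
    · simp; decide
  coord := RingHom.fst ℝ (ℝ × ZMod 5)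
  coord_gen := rfl

theorem cos_pi_div_five_eq : cos (π / 5) = goldenRatio / 2 := by
  rw [cos_pi_div_five, goldenRatio]; ring

theorem sin_pi_div_five_pos : 0 < sin (π / 5) :=
  sin_pos_of_pos_of_lt_pi (by positivity) (by linarith [pi_pos])

theorem sin_pi_div_five_sq : sin (π / 5) ^ 2 = (3 - goldenRatio) / 4 := by
  have := sin_sq_add_cos_sq (π / 5)
  rw [cos_pi_div_five_eq] at this
  linear_combination this - 1 / 4 * goldenRatio_sq

theorem sin_pi_div_ten : sin (π / 10) = (goldenRatio - 1) / 2 := by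
  rw [← cos_pi_div_two_sub, show π / 2 - π / 10 = 2 * (π / 5) by ring, cos_two_mul,
    cos_pi_div_five_eq]
  linear_combination 1 / 2 * goldenRatio_sq

theorem cos_pi_div_ten : cos (π / 10) = goldenRatio * sin (π / 5) := by
  rw [show π / 5 = 2 * (π / 10) by ring, sin_two_mul, sin_pi_div_ten]
  linear_combination -cos (π / 10) * goldenRatio_sq

/-- Position of a side in the cyclic order of the sides, which starts with side `2`. -/
def cyclicIndex : Fin 5 ≃ ZMod 5 where
  toFun := ![3, 1, 0, 2, 4]
  invFun := ![2, 1, 3, 0, 4]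
  left_inv := by change ∀ j : Fin 5, _; decide
  right_inv := by
    change ∀ j, (![3, 1, 0, 2, 4] : Fin 5 → Fin 5) ((![2, 1, 3, 0, 4] : Fin 5 → Fin 5) j) = j
    decide

theorem normal_eq (j : Fin 5) : normal j =
    ![!₂[0, -1], !₂[-sin (π / 5), goldenRatio / 2], !₂[sin (π / 5), goldenRatio / 2],
      !₂[-(goldenRatio * sin (π / 5)), -((goldenRatio - 1) / 2)],
      !₂[goldenRatio * sin (π / 5), -((goldenRatio - 1) / 2)]] j := by
  rw [← cos_pi_div_ten, ← sin_pi_div_ten, ← cos_pi_div_five_eq]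
  fin_cases j <;> simp only [normal, normalAngle]
  · simp [show 3 * π / 2 = π / 2 + π by ring, cos_add_pi, sin_add_pi]
  · simp [show 7 * π / 10 = π / 5 + π / 2 by ring, cos_add_pi_div_two, sin_add_pi_div_two]
  · simp [show 3 * π / 10 = π / 2 - π / 5 by ring, cos_pi_div_two_sub, sin_pi_div_two_sub]
  · simp [show 11 * π / 10 = π / 10 + π by ring, cos_add_pi, sin_add_pi]
  · simp [show 19 * π / 10 = -(π / 10) + 2 * π by ring, cos_add_two_pi, sin_add_two_pi]

theorem inner_eq (x y : Plane) : inner ℝ x y = x 0 * y 0 + x 1 * y 1 := by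
  simp [PiLp.inner_apply, Fin.sum_univ_two, mul_comm]

/-- Inner products of the normals in cyclic order. -/
noncomputable def normalCos : ZMod 5 → ℝ :=
  ![1, (goldenRatio - 1) / 2, -goldenRatio / 2, -goldenRatio / 2, (goldenRatio - 1) / 2]

noncomputable def normalSin : ZMod 5 → ℝ :=
  ![0, goldenRatio * sin (π / 5), sin (π / 5), -sin (π / 5), -(goldenRatio * sin (π / 5))]

theorem normalCos_values : normalCos 0 = 1 ∧ normalCos 1 = (goldenRatio - 1) / 2 ∧
    normalCos 2 = -goldenRatio / 2 ∧ normalCos 3 = -goldenRatio / 2 ∧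
    normalCos 4 = (goldenRatio - 1) / 2 := ⟨rfl, rfl, rfl, rfl, rfl⟩

theorem normalSin_values : normalSin 0 = 0 ∧ normalSin 1 = goldenRatio * sin (π / 5) ∧
    normalSin 2 = sin (π / 5) ∧ normalSin 3 = -sin (π / 5) ∧
    normalSin 4 = -(goldenRatio * sin (π / 5)) := ⟨rfl, rfl, rfl, rfl, rfl⟩

/-- The signed distance of `x` from the axis through the midpoint of side `j`. -/
noncomputable def offAxis (j : Fin 5) (x : Plane) : ℝ := normal j 0 * x 1 - normal j 1 * x 0

theorem normal_rotate (i j : Fin 5) :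
    normal i 0 = normalCos (cyclicIndex i - cyclicIndex j) * normal j 0 -
      normalSin (cyclicIndex i - cyclicIndex j) * normal j 1 ∧
    normal i 1 = normalCos (cyclicIndex i - cyclicIndex j) * normal j 1 +
      normalSin (cyclicIndex i - cyclicIndex j) * normal j 0 := by
  have hs := sin_pi_div_five_sq
  have hq := goldenRatio_sq
  obtain ⟨h0, h1, h2, h3, h4⟩ := normalCos_values
  obtain ⟨g0, g1, g2, g3, g4⟩ := normalSin_values
  have hd : cyclicIndex i - cyclicIndex j = ![![0, 2, 3, 1, 4], ![3, 0, 1, 4, 2],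
    ![2, 4, 0, 3, 1], ![4, 1, 2, 0, 3], ![1, 3, 4, 2, 0]] i j := by revert i j; decide
  rw [normal_eq, normal_eq, hd]
  generalize sin (π / 5) = σ at *
  generalize goldenRatio = φ at *
  fin_cases i <;> fin_cases j <;> simp [h0, h1, h2, h3, h4, g0, g1, g2, g3, g4] <;> grind

theorem inner_normal (x : Plane) (i j : Fin 5) : inner ℝ x (normal i) =
    normalCos (cyclicIndex i - cyclicIndex j) * inner ℝ x (normal j) +
      normalSin (cyclicIndex i - cyclicIndex j) * offAxis j x := by
  rw [inner_eq, inner_eq, offAxis, (normal_rotate i j).1, (normal_rotate i j).2]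
  ring

end PentagonBilliard

namespace PentagonBilliard
open Real

/-- Scale between distances in the table and transverse coordinates. -/
noncomputable def scale : ℝ := (6 * goldenRatio + 2) / 5

theorem scale_pos : 0 < scale := by unfold scale; have := goldenRatio_pos; positivity

/-- This identity fixes the constant: half a side has length `tan (π/5) = 2 sin (π/5) / φ`, and with
this scale its transverse half-width is exactly `width`. -/
theorem scale_mul_sq : scale * sin (π / 5) ^ 2 = goldenRatio / 2 := by
  rw [sin_pi_div_five_sq, scale]
  linear_combination -3 / 10 * goldenRatio_sq

/-- The system of a direction with golden coordinates `a`, `b`, with a coordinate for the flight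
time and one for the rotational part of the unfolding. -/
def system (a b : ℝ) : (ℝ × ℝ × ZMod 5) × (ℝ × ℝ × ZMod 5) := ((a, 0, 2), (b, 1, 2))

/-- The direction with golden coordinates `a`, `b`. -/
noncomputable def ofGoldenL (a b : ℝ) : Plane := !₂[a + goldenRatio / 2 * b, sin (π / 5) * b]

/-- Transverse coordinate of a point with respect to a direction. -/
noncomputable def offset (a b : ℝ) (x : Plane) : ℝ :=
  scale * ((a + goldenRatio / 2 * b) * x 1 - sin (π / 5) * b * x 0) + scale * a +
    (1 + scale * (goldenRatio / 2)) * b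

theorem ofGoldenL_toGoldenL (u : Plane) : ofGoldenL (toGoldenL u 0) (toGoldenL u 1) = u := by
  have hs := sin_pi_div_five_pos.ne'
  have hdet : IsUnit P.det := by rw [P, Matrix.det_fin_two_of]; simpa using hs
  have h : P.mulVec (toGoldenL u) = u.ofLp := by
    rw [toGoldenL, Matrix.mulVec_mulVec, Matrix.mul_nonsing_inv _ hdet, Matrix.one_mulVec]
  have h0 := congrFun h 0
  have h1 := congrFun h 1
  simp [P, Matrix.mulVec, dotProduct, Fin.sum_univ_two, -cos_pi_div_five] at h0 h1
  rw [cos_pi_div_five_eq] at h0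
  ext i
  fin_cases i
  · simpa [ofGoldenL] using h0
  · simpa [ofGoldenL] using h1

theorem sin_mul_sin : sin (π / 5) * sin (π / 5) = (3 - goldenRatio) / 4 := by
  rw [← sq, sin_pi_div_five_sq]

/-- The constant terms of `offset` are chosen for the first component. The second is the same
function for the direction `(0, 1)`, and the entries `2, 2` of `system` turn the third into the
cyclic index, shifted by 4. -/
theorem center_system (a b : ℝ) (j : Fin 5) :
    center (system a b) j = (offset a b (normal j), offset 0 1 (normal j), cyclicIndex j + 4) := by
  have hg : (g : ℝ × ℝ × ZMod 5) = (goldenRatio, goldenRatio, 3) := rfl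
  have h2 : (2 : ℝ × ℝ × ZMod 5) = (2, 2, 2) := rfl
  have h1 : (1 : ℝ × ℝ × ZMod 5) = (1, 1, 1) := rfl
  have hs := sin_mul_sin
  have hq := goldenRatio_sq
  refine Prod.ext ?_ (Prod.ext ?_ ?_)
  · dsimp only
    rw [offset, normal_eq]
    fin_cases j <;> simp [center, system, scale, hg, h1, h2] <;> grind
  · dsimp only
    rw [offset, normal_eq]
    fin_cases j <;> simp [center, system, scale, hg, h1, h2] <;> grind
  · fin_cases j <;> simp [center, system, hg, h1, h2, cyclicIndex] <;> decide

/-- The sign of the velocity in a state. -/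
def sgn (e : Bool) : ℝ := if e then 1 else -1

theorem sgn_not (e : Bool) : sgn (!e) = -sgn e := by cases e <;> simp [sgn]

theorem sgn_mul_self (e : Bool) : sgn e * sgn e = 1 := by cases e <;> simp [sgn]

theorem inner_ofGoldenL (a b : ℝ) (j : Fin 5) :
    inner ℝ (ofGoldenL a b) (normal j) =
      sgn (isFwd j) * (sin (π / 5) * proj (width (system a b) j)) := by
  have hq := goldenRatio_sq
  rw [inner_eq, normal_eq]
  fin_cases j <;> simp [ofGoldenL, width, system, isFwd, sgn, proj_mul, proj_add] <;>
    simp [proj, GoldenRing.coord] <;> grind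

theorem offset_sub (a b : ℝ) {y : Plane} {j : Fin 5} (hy : inner ℝ y (normal j) = 1) :
    offset a b y - offset a b (normal j) =
      scale * offAxis j y * inner ℝ (ofGoldenL a b) (normal j) := by
  have h1 : normal j 0 ^ 2 + normal j 1 ^ 2 = 1 := by simp [normal]
  simp only [inner_eq] at hy
  simp only [offset, offAxis, inner_eq, ofGoldenL]
  simp
  generalize sin (π / 5) = σ at *
  generalize goldenRatio = φ at *
  generalize normal j 0 = c at *
  generalize normal j 1 = d at *
  have e0 : y 0 = c - (c * y 1 - d * y 0) * d := by linear_combination y 0 * (-h1) + c * hy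
  have e1 : y 1 = d + (c * y 1 - d * y 0) * c := by linear_combination y 1 * (-h1) + d * hy
  linear_combination scale * (a + φ / 2 * b) * e1 - scale * σ * b * e0

theorem abs_offset_sub (a b : ℝ) {y : Plane} {j : Fin 5} (hy : inner ℝ y (normal j) = 1)
    (hw : 0 ≤ proj (width (system a b) j)) :
    2 * sin (π / 5) * |offset a b y - offset a b (normal j)| =
      goldenRatio * |offAxis j y| * proj (width (system a b) j) := by
  have hs : |sgn (isFwd j)| = 1 := by cases isFwd j <;> simp [sgn]
  rw [offset_sub a b hy, inner_ofGoldenL, abs_mul, abs_mul, abs_mul, abs_mul, hs,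
    abs_of_pos scale_pos, abs_of_pos sin_pi_div_five_pos, abs_of_nonneg hw]
  linear_combination 2 * |offAxis j y| * proj (width (system a b) j) * scale_mul_sq

theorem mem_openSide_iff {y : Plane} {j : Fin 5} (hy : inner ℝ y (normal j) = 1) :
    y ∈ openSide j ↔ goldenRatio * |offAxis j y| < 2 * sin (π / 5) := by
  have hs := sin_mul_sin
  have hp := sin_pi_div_five_pos
  have hφ := one_lt_goldenRatio
  obtain ⟨h0, h1, h2, h3, h4⟩ := normalCos_values
  obtain ⟨g0, g1, g2, g3, g4⟩ := normalSin_values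
  -- Multiplied by `sin (π/5)`, the bound becomes polynomial in `φ`, and its two halves are the
  -- conditions of the two neighbouring sides.
  have key : goldenRatio * |offAxis j y| < 2 * sin (π / 5) ↔
      goldenRatio * sin (π / 5) * offAxis j y < (3 - goldenRatio) / 2 ∧
      -(goldenRatio * sin (π / 5) * offAxis j y) < (3 - goldenRatio) / 2 := by
    have hsφ : 0 < goldenRatio * sin (π / 5) := by positivity
    rw [← mul_lt_mul_iff_right₀ hp]
    rcases abs_cases (offAxis j y) with ⟨h, h'⟩ | ⟨h, h'⟩ <;> rw [h] <;>
      constructor <;> intro h'' <;> (try constructor) <;> nlinarith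
  rw [key]
  constructor
  · rintro ⟨-, h⟩
    have hij : ∀ k : ZMod 5, k ≠ 0 → cyclicIndex.symm (cyclicIndex j + k) ≠ j := by
      intro k hk h
      exact hk (by simpa using (cyclicIndex.symm_apply_eq).1 h)
    have e1 := h _ (hij 1 (by decide))
    have e4 := h _ (hij 4 (by decide))
    rw [inner_normal y _ j, hy] at e1 e4
    simp only [Equiv.apply_symm_apply, add_sub_cancel_left, h1, h4, g1, g4] at e1 e4
    constructor <;> linarith
  · rintro ⟨e1, e2⟩
    refine ⟨hy, fun i hi => ?_⟩
    have hk : cyclicIndex i - cyclicIndex j ≠ 0 := by simpa [sub_eq_zero] using hi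
    rw [inner_normal y i j, hy]
    revert hk
    generalize cyclicIndex i - cyclicIndex j = k
    intro hk
    have : k = 1 ∨ k = 2 ∨ k = 3 ∨ k = 4 := by revert k; decide
    rcases this with rfl | rfl | rfl | rfl
    · rw [h1, g1]; linarith
    · rw [h2, g2]; rcases le_total (sin (π / 5) * offAxis j y) 0 with h | h <;> nlinarith
    · rw [h3, g3]; rcases le_total (sin (π / 5) * offAxis j y) 0 with h | h <;> nlinarith
    · rw [h4, g4]; linarith

theorem mem_corners {y : Plane} {j : Fin 5} (hy : inner ℝ y (normal j) = 1)
    (h : goldenRatio * |offAxis j y| = 2 * sin (π / 5)) : y ∈ corners := by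
  have hs := sin_mul_sin
  have hp := sin_pi_div_five_pos
  have hφ := one_lt_goldenRatio
  obtain ⟨h0, h1, h2, h3, h4⟩ := normalCos_values
  obtain ⟨g0, g1, g2, g3, g4⟩ := normalSin_values
  have key : goldenRatio * sin (π / 5) * offAxis j y = (3 - goldenRatio) / 2 ∨
      goldenRatio * sin (π / 5) * offAxis j y = -((3 - goldenRatio) / 2) := by
    rcases abs_cases (offAxis j y) with ⟨h', -⟩ | ⟨h', -⟩ <;> rw [h'] at h
    · left; linear_combination sin (π / 5) * h + 2 * hs
    · right; linear_combination -sin (π / 5) * h - 2 * hs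
  have hle : ∀ i, inner ℝ y (normal i) ≤ 1 := by
    intro i
    rw [inner_normal y i j, hy]
    generalize cyclicIndex i - cyclicIndex j = k
    have : k = 0 ∨ k = 1 ∨ k = 2 ∨ k = 3 ∨ k = 4 := by revert k; decide
    have hφ2 := goldenRatio_lt_two
    rcases this with rfl | rfl | rfl | rfl | rfl
    · rw [h0, g0]; linarith
    · rw [h1, g1]; rcases key with key | key <;> linarith
    · rw [h2, g2]; rcases le_total (sin (π / 5) * offAxis j y) 0 with h | h <;>
        rcases key with key | key <;> nlinarith
    · rw [h3, g3]; rcases le_total (sin (π / 5) * offAxis j y) 0 with h | h <;>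
        rcases key with key | key <;> nlinarith
    · rw [h4, g4]; rcases key with key | key <;> linarith
  refine ⟨hle, j, ?_⟩
  have hij : ∀ k : ZMod 5, k ≠ 0 → j ≠ cyclicIndex.symm (cyclicIndex j + k) := by
    intro k hk h
    exact hk (by simpa using (cyclicIndex.symm_apply_eq).1 h.symm)
  rcases key with key | key
  · refine ⟨_, hij 1 (by decide), hy, ?_⟩
    rw [inner_normal y _ j, hy]
    simp only [Equiv.apply_symm_apply, add_sub_cancel_left, h1, g1]
    linarith
  · refine ⟨_, hij 4 (by decide), hy, ?_⟩
    rw [inner_normal y _ j, hy]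
    simp only [Equiv.apply_symm_apply, add_sub_cancel_left, h4, g4]
    linarith

/-- The symmetry of the table which fixes the midpoint of side `j`. -/
noncomputable def flip (j : Fin 5) : Plane ≃ₗᵢ[ℝ] Plane := (ℝ ∙ normal j).reflection

theorem inner_normal_self (j : Fin 5) : inner ℝ (normal j) (normal j) = 1 := by
  rw [inner_eq, ← sq, ← sq]; simp [normal]

theorem flip_apply (j : Fin 5) (x : Plane) :
    flip j x = (2 * inner ℝ x (normal j)) • normal j - x := by
  have h : ‖normal j‖ = 1 := by
    have := inner_normal_self j
    rw [real_inner_self_eq_norm_sq] at this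
    exact (pow_eq_one_iff_of_nonneg (norm_nonneg _) two_ne_zero).1 this
  rw [flip, Submodule.reflection_apply, Submodule.starProjection_unit_singleton ℝ h,
    real_inner_comm, two_mul, add_smul, two_smul]

/-- The permutation of the sides induced by `flip j`. -/
def flipPerm (j : Fin 5) : Equiv.Perm (Fin 5) where
  toFun i := cyclicIndex.symm (2 * cyclicIndex j - cyclicIndex i)
  invFun i := cyclicIndex.symm (2 * cyclicIndex j - cyclicIndex i)
  left_inv i := by simp
  right_inv i := by simp

theorem flipPerm_apply (i j : Fin 5) :
    cyclicIndex (flipPerm j i) = 2 * cyclicIndex j - cyclicIndex i := by simp [flipPerm]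

theorem isTableSymmetry_flip (j : Fin 5) : IsTableSymmetry (flip j) (flipPerm j) := by
  intro i
  have hc : ∀ k, normalCos (-k) = normalCos k := by
    intro k
    have : k = 0 ∨ k = 1 ∨ k = 2 ∨ k = 3 ∨ k = 4 := by revert k; decide
    rcases this with rfl | rfl | rfl | rfl | rfl <;> rfl
  have hd : ∀ k, normalSin (-k) = -normalSin k := by
    intro k
    obtain ⟨g0, g1, g2, g3, g4⟩ := normalSin_values
    have e1 : (-1 : ZMod 5) = 4 := rfl
    have e2 : (-2 : ZMod 5) = 3 := rfl
    have e3 : (-3 : ZMod 5) = 2 := rfl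
    have e4 : (-4 : ZMod 5) = 1 := rfl
    have : k = 0 ∨ k = 1 ∨ k = 2 ∨ k = 3 ∨ k = 4 := by revert k; decide
    rcases this with rfl | rfl | rfl | rfl | rfl <;> simp [g0, g1, g2, g3, g4, e1, e2, e3, e4]
  obtain ⟨a0, a1⟩ := normal_rotate i j
  obtain ⟨b0, b1⟩ := normal_rotate (flipPerm j i) j
  rw [flipPerm_apply, show 2 * cyclicIndex j - cyclicIndex i - cyclicIndex j =
    -(cyclicIndex i - cyclicIndex j) by ring, hc, hd] at b0 b1
  have h1 := inner_normal_self j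
  rw [inner_eq] at h1
  rw [sideMid, sideMid, flip_apply, inner_eq, a0, a1]
  ext l
  fin_cases l
  · simp [b0, a0]
    linear_combination 2 * normalCos (cyclicIndex i - cyclicIndex j) * normal j 0 * h1
  · simp [b1, a1]
    linear_combination 2 * normalCos (cyclicIndex i - cyclicIndex j) * normal j 1 * h1

end PentagonBilliard

/-! ### Unfolding billiard paths to the transverse system -/

namespace PentagonBilliard
open Real (sin goldenRatio)

section symmetry
variable {A B : Plane ≃ₗᵢ[ℝ] Plane} {π ρ : Equiv.Perm (Fin 5)}

theorem IsTableSymmetry.mul (hA : IsTableSymmetry A π) (hB : IsTableSymmetry B ρ) :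
    IsTableSymmetry (B.trans A) (π * ρ) := fun j => by
  simp [hB j, hA (ρ j)]

theorem IsTableSymmetry.symm (hA : IsTableSymmetry A π) : IsTableSymmetry A.symm π⁻¹ := fun j => by
  rw [LinearIsometryEquiv.symm_apply_eq, hA]; simp

theorem IsTableSymmetry.inner_normal (hA : IsTableSymmetry A π) (x : Plane) (j : Fin 5) :
    inner ℝ (A x) (normal (π j)) = inner ℝ x (normal j) := by
  have := hA j
  rw [sideMid, sideMid] at this
  rw [← this, LinearIsometryEquiv.inner_map_map]

theorem IsTableSymmetry.mem_openSide (hA : IsTableSymmetry A π) (x : Plane) (j : Fin 5) :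
    A x ∈ openSide (π j) ↔ x ∈ openSide j := by
  simp only [openSide, Set.mem_ofPred_eq, hA.inner_normal, ← π.forall_congr_right (q := fun i =>
    i ≠ π j → inner ℝ (A x) (normal i) < 1), π.injective.ne_iff]

theorem IsTableSymmetry.mem_table (hA : IsTableSymmetry A π) (x : Plane) :
    A x ∈ table ↔ x ∈ table := by
  simp only [table, Set.mem_ofPred_eq, hA.inner_normal, ← π.forall_congr_right (q := fun i =>
    inner ℝ (A x) (normal i) ≤ 1)]

theorem IsTableSymmetry.mem_corners (hA : IsTableSymmetry A π) {x : Plane} (hx : x ∈ corners) :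
    A x ∈ corners := by
  obtain ⟨h, i, j, hij, hi, hj⟩ := hx
  exact ⟨(hA.mem_table x).2 h, π i, π j, π.injective.ne hij, by rw [hA.inner_normal, hi],
    by rw [hA.inner_normal, hj]⟩

theorem IsTableSymmetry.reflect (hA : IsTableSymmetry A π) (x : Plane) (j : Fin 5) :
    reflect (π j) (A x) = A (reflect j x) := by
  have := hA j
  rw [sideMid, sideMid] at this
  rw [PentagonBilliard.reflect, hA.inner_normal, ← this, PentagonBilliard.reflect]
  simp

end symmetry

theorem openSide_subset_table (j : Fin 5) : openSide j ⊆ table := by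
  rintro x ⟨h, h'⟩ i
  rcases eq_or_ne i j with rfl | hi
  · exact h.le
  · exact (h' i hi).le

theorem sideMid_mem_table (j : Fin 5) : sideMid j ∈ table := by
  refine openSide_subset_table j ((mem_openSide_iff (inner_normal_self j)).2 ?_)
  have : offAxis j (normal j) = 0 := by rw [offAxis]; ring
  rw [this]
  simpa using sin_pi_div_five_pos

variable {a b : ℝ} {e₀ : Bool} {d : ZMod 5} {p q w : Plane} {T : ℝ}
  {ω : Bool × (ℝ × ℝ × ZMod 5)} {j : Fin 5}

/-- The sign by which the unfolded table is rotated or reflected. -/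
def turn (e₀ e : Bool) : ZMod 5 := if e = e₀ then 1 else -1

theorem turn_not (e₀ e : Bool) : turn e₀ (!e) = -turn e₀ e := by
  cases e₀ <;> cases e <;> rfl

theorem turn_self (e : Bool) : turn e e = 1 := by simp [turn]

/-- The ball at `q` with velocity `w` after the time `T` unfolds to the state `ω`. -/
def Unfolds (a b : ℝ) (e₀ : Bool) (d : ZMod 5) (q w : Plane) (T : ℝ)
    (ω : Bool × (ℝ × ℝ × ZMod 5)) : Prop :=
  ∃ (M : Plane ≃ₗᵢ[ℝ] Plane) (π : Equiv.Perm (Fin 5)) (z : ZMod 5) (x : Plane),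
    IsTableSymmetry M π ∧
    (∀ j, cyclicIndex j = turn e₀ ω.1 * cyclicIndex (π j) + z) ∧
    q = M x ∧ w = M (sgn ω.1 • ofGoldenL a b) ∧
    ω.2 = (offset a b x, offset 0 1 x + scale * sin (Real.pi / 5) * a * sgn ω.1 * T,
      z + 4 + turn e₀ ω.1 * d)


/-- The shift `d` of the rotational part is free; `d = cyclicIndex J` makes the midpoint of side `J`
start exactly at `center (system a b) J`. -/
theorem Unfolds.start (a b : ℝ) (e : Bool) (d : ZMod 5) (p : Plane) :
    Unfolds a b e d p (sgn e • ofGoldenL a b) 0 (e, offset a b p, offset 0 1 p, 4 + d) :=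
  ⟨.refl ℝ _, 1, 0, p, fun _ => rfl, by simp [turn_self], rfl, rfl, by simp [turn_self]⟩

theorem Unfolds.norm (h : Unfolds a b e₀ d q w T ω) : ‖w‖ = ‖ofGoldenL a b‖ := by
  obtain ⟨M, π, z, x, -, -, -, rfl, -⟩ := h
  rw [LinearIsometryEquiv.norm_map, norm_smul]
  cases ω.1 <;> simp [sgn]

theorem abs_offset_sub_lt_iff {y : Plane} (hy : inner ℝ y (normal j) = 1)
    (hw : 0 < proj (width (system a b) j)) :
    |offset a b y - offset a b (normal j)| < proj (width (system a b) j) ↔ y ∈ openSide j := by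
  have h := abs_offset_sub a b hy hw.le
  rw [mem_openSide_iff hy, ← mul_lt_mul_iff_right₀ (mul_pos two_pos sin_pi_div_five_pos), h,
    mul_lt_mul_iff_left₀ hw]

theorem sgn_mul_sgn_pos_iff {e e' : Bool} {c : ℝ} (hc : 0 ≤ c) :
    0 < sgn e * (sgn e' * c) ↔ e' = e ∧ 0 < c := by
  cases e <;> cases e' <;> simp [sgn] <;> linarith

theorem offset_add_smul (a b : ℝ) (x : Plane) (t : ℝ) :
    offset a b (x + t • ofGoldenL a b) = offset a b x := by
  simp only [offset, ofGoldenL, PiLp.add_apply, PiLp.smul_apply, smul_eq_mul, Matrix.cons_val_zero,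
    Matrix.cons_val_one]
  ring

theorem offset_zero_one_add_smul (a b : ℝ) (x : Plane) (t : ℝ) :
    offset 0 1 (x + t • ofGoldenL a b) = offset 0 1 x - scale * sin (Real.pi / 5) * a * t := by
  simp [offset, ofGoldenL, -Real.cos_pi_div_five]
  ring

theorem proj_center_system (a b : ℝ) (j : Fin 5) :
    proj (center (system a b) j) = offset a b (normal j) := by
  rw [center_system]; rfl

/-- The factor `flip i` of the reflection is absorbed into `M`, which leaves the half turn `y ↦ 2 •
normal i - y` on the unfolded point. Straight flight changes `offset 0 1` by the opposite of the
time term, so the second component stays constant between bounces. -/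
theorem Unfolds.bounce (hs : Admissible (system a b)) (h : Unfolds a b e₀ d q w T ω) {t : ℝ}
    (hside : q + t • w ∈ openSide j) (hout : 0 < inner ℝ w (normal j)) :
    ∃ i, Heads (system a b) i ω ∧
      Unfolds a b e₀ d (q + t • w) (reflect j w) (T + t) (bounce (system a b) i ω) := by
  obtain ⟨M, π, z, x, hM, hπ, rfl, rfl, hω⟩ := h
  obtain ⟨i, rfl⟩ := π.surjective j
  obtain ⟨e, X⟩ := ω
  dsimp only at hπ hω hside hout ⊢
  have hx : M x + t • M (sgn e • ofGoldenL a b) = M (x + (t * sgn e) • ofGoldenL a b) := by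
    rw [← map_smul, ← map_add, smul_smul]
  rw [hx, hM.mem_openSide] at hside
  rw [hM.inner_normal, real_inner_smul_left, inner_ofGoldenL,
    sgn_mul_sgn_pos_iff (mul_nonneg sin_pi_div_five_pos.le (width_nonneg hs i)),
    mul_pos_iff_of_pos_left sin_pi_div_five_pos] at hout
  have hy := hside.1
  refine ⟨i, ⟨hout.1, ?_⟩, ?_⟩
  · have := (abs_offset_sub_lt_iff (a := a) (b := b) hy hout.2).2 hside
    rw [offset_add_smul] at this
    rw [proj_sub, proj_center_system, hω]
    exact this
  · set y := x + (t * sgn e) • ofGoldenL a b with hydef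
    have hfy : flip i ((2 : ℝ) • normal i - y) = y := by
      rw [flip_apply, inner_sub_left, real_inner_smul_left, inner_normal_self, hy]
      norm_num
    have hfu : flip i (sgn (!e) • ofGoldenL a b) =
        reflect i (sgn e • ofGoldenL a b) := by
      rw [flip_apply, PentagonBilliard.reflect, sgn_not, neg_smul, inner_neg_left]
      module
    refine ⟨(flip i).trans M, π * flipPerm i, 2 * cyclicIndex i - z, (2 : ℝ) • normal i - y,
      hM.mul (isTableSymmetry_flip i), fun k => ?_, ?_, ?_, ?_⟩
    · have := hπ (flipPerm i k)
      rw [flipPerm_apply] at this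
      dsimp only [PentagonBilliard.bounce]
      rw [turn_not, Equiv.Perm.mul_apply]
      linear_combination -this
    · rw [LinearIsometryEquiv.trans_apply, hfy, hx]
    · rw [LinearIsometryEquiv.trans_apply, hM.reflect]
      dsimp only [PentagonBilliard.bounce]
      rw [hfu]
    · dsimp only [PentagonBilliard.bounce]
      have h1 : ∀ a b, offset a b ((2 : ℝ) • normal i - y) =
          2 * offset a b (normal i) - offset a b y := by
        intro a b; simp [offset]; ring
      have h2 : (2 : ℝ × ℝ × ZMod 5) = (2, 2, 2) := rfl
      rw [hω, center_system, turn_not, sgn_not, h1, h1, hydef, offset_add_smul,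
        offset_zero_one_add_smul, h2]
      refine Prod.ext ?_ (Prod.ext ?_ ?_)
      · simp
      · simp only [Prod.mk_mul_mk, Prod.mk_sub_mk]
        ring
      · simp only [Prod.mk_mul_mk, Prod.mk_sub_mk]
        ring

theorem Unfolds.exists_side (hs : Admissible (system a b)) (h : Unfolds a b e₀ d q w T ω)
    (hq : q ∈ table) {i : Fin 5} (hwi : 0 < proj (width (system a b) i)) (he : isFwd i = ω.1) :
    ∃ j, ∃ t : ℝ, 0 ≤ t ∧ inner ℝ (q + t • w) (normal j) = 1 ∧ 0 < inner ℝ w (normal j) ∧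
      (|proj (ω.2 - center (system a b) i)| < proj (width (system a b) i) →
        q + t • w ∈ openSide j) ∧
      (|proj (ω.2 - center (system a b) i)| = proj (width (system a b) i) →
        q + t • w ∈ corners) := by
  obtain ⟨M, π, z, x, hM, hπ, rfl, rfl, hω⟩ := h
  obtain ⟨e, X⟩ := ω
  dsimp only at hπ hω he ⊢
  have hpos : 0 < inner ℝ (sgn e • ofGoldenL a b) (normal i) := by
    rw [real_inner_smul_left, inner_ofGoldenL,
      sgn_mul_sgn_pos_iff (mul_nonneg sin_pi_div_five_pos.le (width_nonneg hs i)),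
      mul_pos_iff_of_pos_left sin_pi_div_five_pos]
    exact ⟨he, hwi⟩
  set t := (1 - inner ℝ x (normal i)) / inner ℝ (sgn e • ofGoldenL a b) (normal i) with ht
  have hx : M x + t • M (sgn e • ofGoldenL a b) = M (x + (t * sgn e) • ofGoldenL a b) := by
    rw [← map_smul, ← map_add, smul_smul]
  have hy : inner ℝ (x + (t * sgn e) • ofGoldenL a b) (normal i) = 1 := by
    rw [mul_smul, inner_add_left, real_inner_smul_left, ht, div_mul_cancel₀ _ hpos.ne']
    ring
  have hX : proj (X - center (system a b) i) =
      offset a b (x + (t * sgn e) • ofGoldenL a b) - offset a b (normal i) := by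
    rw [offset_add_smul, proj_sub, proj_center_system, hω]
    rfl
  refine ⟨π i, t, div_nonneg ?_ hpos.le, ?_, ?_, fun h => ?_, fun h => ?_⟩
  · have := (hM.mem_table x).1 hq i
    linarith
  · rw [hx, hM.inner_normal, hy]
  · rwa [hM.inner_normal]
  · rw [hx, hM.mem_openSide, ← abs_offset_sub_lt_iff hy hwi, ← hX]
    exact h
  · rw [hx]
    refine hM.mem_corners (mem_corners hy ?_)
    have h1 := abs_offset_sub a b hy hwi.le
    rw [← hX, h] at h1
    exact (mul_right_cancel₀ hwi.ne' h1).symm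

theorem Unfolds.of_billiardPath (hs : Admissible (system a b)) {n : ℕ} {L : ℝ}
    (h : BilliardPath p (sgn e₀ • ofGoldenL a b) n L q w) :
    ∃ T ω, 0 ≤ T ∧ L = T * ‖ofGoldenL a b‖ ∧
      Path (system a b) n (e₀, offset a b p, offset 0 1 p, 4 + d) ω ∧
      Unfolds a b e₀ d q w T ω := by
  induction h with
  | start => exact ⟨0, _, le_rfl, by simp, .nil _, .start a b e₀ d p⟩
  | bounce h t ht j hside hout ih =>
    obtain ⟨T, ω, hT, rfl, hp, hω⟩ := ih
    obtain ⟨i, hi, hω'⟩ := hω.bounce hs hside hout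
    refine ⟨T + t, _, by positivity, ?_, hp.snoc hi, hω'⟩
    rw [norm_smul, hω.norm, Real.norm_of_nonneg ht]
    ring

theorem exists_billiardPath (hs : Admissible (system a b)) (hp : p ∈ table) {n : ℕ}
    (h : Path (system a b) n (e₀, offset a b p, offset 0 1 p, 4 + d) ω) :
    ∃ q w T, 0 ≤ T ∧ q ∈ table ∧ BilliardPath p (sgn e₀ • ofGoldenL a b) n (T * ‖ofGoldenL a b‖) q w ∧
      Unfolds a b e₀ d q w T ω ∧
      (0 < n → ∃ j, inner ℝ q (normal j) = 1 ∧ inner ℝ w (normal j) < 0) := by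
  induction n generalizing ω with
  | zero =>
    obtain rfl := h.eq_of_zero
    exact ⟨p, _, 0, le_rfl, hp, by rw [zero_mul]; exact .start, .start a b e₀ d p, by simp⟩
  | succ n ih =>
    obtain ⟨ω', i, hp', hi, rfl⟩ := h.exists_snoc
    obtain ⟨q, w, T, hT, hq, hb, hω, -⟩ := ih hp'
    obtain ⟨j, t, ht, h1, hout, hside, -⟩ :=
      hω.exists_side hs hq ((abs_nonneg _).trans_lt hi.2) hi.1
    obtain ⟨i', hi', hω'⟩ := hω.bounce hs (hside hi.2) hout
    obtain rfl := hi.unique hs hi'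
    refine ⟨q + t • w, reflect j w, T + t, by positivity, openSide_subset_table j (hside hi.2), ?_, hω',
      fun _ => ⟨j, h1, ?_⟩⟩
    · have := hb.bounce t ht j (hside hi.2) hout
      rw [norm_smul, hω.norm, Real.norm_of_nonneg ht] at this
      rwa [add_mul]
    · rw [reflect, inner_sub_left, real_inner_smul_left, inner_normal_self]
      linarith

theorem hitsCorner_of_dies (hs : Admissible (system a b)) (hp : p ∈ table)
    (h : Dies (system a b) (e₀, offset a b p, offset 0 1 p, 4 + d)) :
    HitsCorner p (sgn e₀ • ofGoldenL a b) := by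
  obtain ⟨n, η, hpath, i, hi, hwi, hdead⟩ := h
  obtain ⟨q, w, T, hT, hq, hb, hω, -⟩ := exists_billiardPath hs hp hpath
  obtain ⟨j, t, ht, -, -, -, hc⟩ := hω.exists_side hs hq hwi hi
  exact ⟨n, _, q, w, t, hb, ht, hc hdead⟩

end PentagonBilliard

/-! ### Closed billiard trajectories and their lengths -/

namespace PentagonBilliard
open Real (sin goldenRatio)

theorem BilliardPath.trans {p v q w r z : Plane} {n m : ℕ} {L L' : ℝ}
    (h : BilliardPath p v n L q w) (h' : BilliardPath q w m L' r z) :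
    BilliardPath p v (n + m) (L + L') r z := by
  induction h' with
  | start => simpa using h
  | bounce _ t ht j hside hout ih => rw [← add_assoc, ← add_assoc]; exact ih.bounce t ht j hside hout

theorem BilliardPath.shift {q v r w : Plane} {s : ℝ} (hs : 0 ≤ s) {m : ℕ} {L : ℝ} (hm : 0 < m)
    (h : BilliardPath (q + s • v) v m L r w) : BilliardPath q v m (L + ‖s • v‖) r w := by
  induction h with
  | start => simp at hm
  | @bounce m L r w h t ht j hside hout ih =>
    rcases Nat.eq_zero_or_pos m with rfl | hm'
    · cases h
      rw [add_assoc q, ← add_smul] at hside ⊢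
      have := BilliardPath.start.bounce (s + t) (by positivity) j hside hout
      convert this using 1
      rw [norm_smul, norm_smul, norm_smul, Real.norm_of_nonneg hs, Real.norm_of_nonneg ht,
        Real.norm_of_nonneg (by positivity)]
      ring
    · have := (ih hm').bounce t ht j hside hout
      convert this using 1
      ring

theorem ReturnsAfter.twice {p v : Plane} {n : ℕ} {L : ℝ} (hn : 0 < n) (h : ReturnsAfter p v n L) :
    ReturnsAfter p v (n + n) (L + L) := by
  obtain ⟨L₀, q, s, hp, hs, rfl, rfl⟩ := h
  exact ⟨L₀ + (L₀ + ‖s • v‖), q, s, hp.trans (hp.shift hs hn), hs, rfl, by ring⟩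

theorem Path.even_iff {K : Type*} [GoldenRing K] {s : K × K} {n : ℕ} {ω η : Bool × K}
    (h : Path s n ω η) : Even n ↔ η.1 = ω.1 := by
  induction h with
  | nil => simp
  | cons j h p ih =>
    rw [Nat.even_add_one, ih]
    simp [bounce]

theorem eq_of_inner_normal {x y : Plane} (h : ∀ j, inner ℝ x (normal j) = inner ℝ y (normal j)) :
    x = y := by
  have h0 := h 0
  have h1 := h 1
  have hs := sin_pi_div_five_pos.ne'
  simp [inner_eq, normal_eq] at h0 h1
  rw [h0] at h1
  ext i
  fin_cases i
  · simpa [hs] using h1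
  · simpa using h0

theorem IsTableSymmetry.eq_self {M : Plane ≃ₗᵢ[ℝ] Plane} (hM : IsTableSymmetry M 1) (x : Plane) :
    M x = x :=
  eq_of_inner_normal fun j => hM.inner_normal x j

variable {a b : ℝ} {e : Bool} {d : ZMod 5} {p q w : Plane} {T : ℝ}
  {ω : Bool × (ℝ × ℝ × ZMod 5)}

theorem perm_eq_one {π : Equiv.Perm (Fin 5)} (h : ∀ j, cyclicIndex j = cyclicIndex (π j)) :
    π = 1 := Equiv.ext fun j => (cyclicIndex.injective (h j)).symm

/-- By `he`, `M` shifts the cyclic order of the sides. Fixing the velocity, it sends the forward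
sides 2 and 4, neighbours with indices 0 and 4, to forward sides, and only the trivial shift does
this. -/
theorem Unfolds.closes (hs : Admissible (system a b))
    (h : Unfolds a b e d q (sgn e • ofGoldenL a b) T ω) (he : ω.1 = e) :
    ω.2 = (offset a b q, offset 0 1 q + scale * sin (Real.pi / 5) * a * sgn e * T, 4 + d) := by
  obtain ⟨M, π, z, x, hM, hπ, rfl, hw, hω⟩ := h
  obtain ⟨e', X⟩ := ω
  obtain rfl : e' = e := he
  dsimp only at hω hπ hw ⊢
  rw [turn_self] at hω hπ
  have hz : ∀ j, isFwd j = true → 0 < proj (width (system a b) j) → isFwd (π j) = true := by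
    intro j hj hwj
    have h1 := hM.inner_normal (sgn e' • ofGoldenL a b) j
    rw [← hw, real_inner_smul_left, real_inner_smul_left] at h1
    have h2 := mul_left_cancel₀ (left_ne_zero_of_mul_eq_one (sgn_mul_self e')) h1
    rw [inner_ofGoldenL, inner_ofGoldenL, hj] at h2
    have h3 : 0 < sgn true * (sin (Real.pi / 5) * proj (width (system a b) j)) := by
      have := mul_pos sin_pi_div_five_pos hwj
      simpa [sgn] using this
    rw [← h2] at h3
    have h4 := (sgn_mul_sgn_pos_iff (e := true) (mul_nonneg sin_pi_div_five_pos.le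
      (width_nonneg hs (π j)))).1 (by simpa [sgn] using h3)
    exact h4.1
  have hg := Real.goldenRatio_pos
  have h2 := hz 2 rfl (by
    have := hs.1; have := hs.2
    rw [show width (system a b) 2 = (system a b).1 + g * (system a b).2 from rfl, proj_add,
      proj_mul, proj_g]; positivity)
  have h4 := hz 4 rfl (by
    have := hs.1; have := hs.2
    rw [show width (system a b) 4 = g * (system a b).1 + (system a b).2 from rfl, proj_add,
      proj_mul, proj_g]; positivity)
  have hz0 : z = 0 := by
    have e2 := hπ 2
    have e4 := hπ 4
    generalize π 2 = i at *
    generalize π 4 = k at *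
    clear hω hπ hw hz
    revert i k z
    decide
  subst hz0
  obtain rfl := perm_eq_one fun j => by simpa using hπ j
  rw [hM.eq_self, hω]
  simp

theorem Unfolds.eq_of_closed {y T : ℝ} {x : ℝ}
    (h : Unfolds a b e d q w T (e, x, y, 4 + d)) : w = sgn e • ofGoldenL a b ∧
      x = offset a b q ∧ y = offset 0 1 q + scale * sin (Real.pi / 5) * a * sgn e * T := by
  obtain ⟨M, π, z, x', hM, hπ, rfl, rfl, hω⟩ := h
  dsimp only at hω hπ ⊢
  rw [turn_self] at hω hπ
  simp only [Prod.mk.injEq] at hω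
  obtain ⟨h1, h2, h3⟩ := hω
  have hz : z = 0 := by linear_combination -h3
  subst hz
  obtain rfl := perm_eq_one fun j => by simpa using hπ j
  rw [hM.eq_self, hM.eq_self]
  exact ⟨rfl, h1, h2⟩

theorem exists_smul_of_offset_eq (hs : Admissible (system a b)) (e : Bool)
    (h : offset a b p = offset a b q) :
    ∃ s : ℝ, p = q + s • sgn e • ofGoldenL a b := by
  have ha : 0 < a := hs.1
  have hb : 0 ≤ b := hs.2
  have hg := Real.goldenRatio_pos
  have hu : a + goldenRatio / 2 * b ≠ 0 := by positivity
  have h1 : (a + goldenRatio / 2 * b) * (p 1 - q 1) =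
      sin (Real.pi / 5) * b * (p 0 - q 0) := by
    have h2 : scale * ((a + goldenRatio / 2 * b) * (p 1 - q 1)) =
        scale * (sin (Real.pi / 5) * b * (p 0 - q 0)) := by
      simp only [offset] at h
      linear_combination h
    exact mul_left_cancel₀ scale_pos.ne' h2
  obtain ⟨c, hc⟩ : ∃ c, p 0 - q 0 = (a + goldenRatio / 2 * b) * c :=
    ⟨(p 0 - q 0) / (a + goldenRatio / 2 * b), (mul_div_cancel₀ _ hu).symm⟩
  have hc' : p 1 - q 1 = sin (Real.pi / 5) * b * c := by
    refine mul_left_cancel₀ hu ?_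
    rw [h1, hc]
    ring
  refine ⟨sgn e * c, ?_⟩
  rw [smul_smul, mul_right_comm, sgn_mul_self, one_mul]
  ext i
  fin_cases i
  · simp [ofGoldenL, -Real.cos_pi_div_five]
    linear_combination hc
  · simp [ofGoldenL]
    linear_combination hc'

/-- Ratio between distances travelled in a direction and its time coordinate. -/
noncomputable def speed (a b : ℝ) : ℝ := ‖ofGoldenL a b‖ / (scale * sin (Real.pi / 5) * a)

theorem speed_pos (hs : Admissible (system a b)) : 0 < speed a b := by
  have ha : 0 < a := hs.1
  have hb : 0 ≤ b := hs.2
  have := scale_pos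
  have := sin_pi_div_five_pos
  have hg := Real.goldenRatio_pos
  have h : ofGoldenL a b ≠ 0 := by
    intro h
    have h0 := congrArg (fun x : Plane => x 0) h
    simp [ofGoldenL] at h0
    have : 0 < a + goldenRatio / 2 * b := by positivity
    linarith
  have := norm_pos_iff.2 h
  unfold speed
  positivity

theorem abs_mul_speed (hs : Admissible (system a b)) (e : Bool) {t : ℝ} (ht : 0 ≤ t) :
    |scale * sin (Real.pi / 5) * a * sgn e * t| * speed a b = t * ‖ofGoldenL a b‖ := by
  have ha : 0 < a := hs.1
  have h1 := scale_pos
  have h2 := sin_pi_div_five_pos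
  have h3 : |sgn e| = 1 := by cases e <;> simp [sgn]
  rw [abs_mul, abs_mul, h3, abs_of_nonneg ht, abs_of_pos (by positivity), speed]
  field_simp

theorem returnsAfter_iff (hs : Admissible (system a b)) (hp : p ∈ table) (e : Bool) (d : ZMod 5)
    (L : ℝ) : (∃ n, 0 < n ∧ Even n ∧ ReturnsAfter p (sgn e • ofGoldenL a b) n L) ↔
      ∃ δ, Ret (system a b) (e, offset a b p, offset 0 1 p, 4 + d) δ ∧ δ.2.2 = 0 ∧
        L = |δ.2.1| * speed a b := by
  have hnorm : ∀ s : ℝ, 0 ≤ s → ‖s • sgn e • ofGoldenL a b‖ = s * ‖ofGoldenL a b‖ := by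
    intro s hs
    rw [norm_smul, norm_smul, Real.norm_of_nonneg hs]
    cases e <;> simp [sgn]
  constructor
  · rintro ⟨n, hn, heven, L₀, q, s, hb, hs0, hpq, rfl⟩
    obtain ⟨T, ω, hT, rfl, hpath, hω⟩ := Unfolds.of_billiardPath (d := d) hs hb
    have he := hpath.even_iff.1 heven
    have hcl := hω.closes hs he
    refine ⟨(0, scale * sin (Real.pi / 5) * a * sgn e * (T + s), 0), ⟨n, hn, ?_, rfl⟩, rfl, ?_⟩
    · convert hpath using 1
      refine Prod.ext he.symm ?_
      rw [hcl, hpq, smul_smul, offset_add_smul, offset_zero_one_add_smul]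
      refine Prod.ext ?_ (Prod.ext ?_ ?_)
      · simp
      · simp only [Prod.mk_add_mk]; ring
      · simp
    · rw [abs_mul_speed hs e (by positivity), hnorm s hs0]
      ring
  · rintro ⟨δ, ⟨n, hn, hpath, hδ⟩, hz, rfl⟩
    have heven := hpath.even_iff.2 rfl
    obtain ⟨q, w, T, hT, hq, hb, hω, hlast⟩ := exists_billiardPath hs hp hpath
    obtain ⟨x, y, z⟩ := δ
    obtain rfl : x = 0 := hδ
    obtain rfl : z = 0 := hz
    simp only [Prod.mk_add_mk, add_zero] at hω
    obtain ⟨rfl, h1, h2⟩ := hω.eq_of_closed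
    obtain ⟨s, hpq⟩ := exists_smul_of_offset_eq hs e h1
    obtain ⟨j, hj1, hj2⟩ := hlast hn
    -- The ball has just left side `j` inwards at `q`; for negative `s` the point `p` would lie
    -- beyond that side, outside the table.
    have hs0 : 0 ≤ s := by
      have := hp j
      rw [hpq, inner_add_left, real_inner_smul_left _ _ s, hj1] at this
      nlinarith
    have hy : y = scale * sin (Real.pi / 5) * a * sgn e * (T + s) := by
      rw [hpq, smul_smul, offset_zero_one_add_smul] at h2
      linear_combination h2
    refine ⟨n, hn, heven, _, q, s, hb, hs0, hpq, ?_⟩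
    dsimp only
    rw [hy, abs_mul_speed hs e (by positivity), hnorm s hs0]
    ring

/-- Number of turns after which a closed unfolded line with rotational part `z` closes up. -/
def turns (z : ZMod 5) : ℝ := if z = 0 then 1 else 5

/-- The returns are the multiples `m` of the period whose rotational part `m * δ.2.2` vanishes
modulo 5; the least one is 1 or, as 5 is prime, 5. -/
theorem hasLength_of_cyc (hs : Admissible (system a b)) (hp : p ∈ table)
    {δ : ℝ × ℝ × ZMod 5} (h : Cyc (system a b) (e, offset a b p, offset 0 1 p, 4 + d) δ) :
    HasLength p (sgn e • ofGoldenL a b) (turns δ.2.2 * (|δ.2.1| * speed a b)) := by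
  obtain ⟨ε, hε, hδ⟩ := h
  have hset : {T | ∃ n, 0 < n ∧ Even n ∧ ReturnsAfter p (sgn e • ofGoldenL a b) n T} =
      {L | ∃ m : ℕ, 0 < m ∧ (m : ZMod 5) * δ.2.2 = 0 ∧ L = m * (|δ.2.1| * speed a b)} := by
    ext L
    simp only [Set.mem_ofPred_eq]
    rw [returnsAfter_iff hs hp e d]
    have hm : ∀ m : ℕ, ((ε * (m * δ)).2.2 = 0 ↔ (m : ZMod 5) * δ.2.2 = 0) ∧
        |(ε * (m * δ)).2.1| = m * |δ.2.1| := by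
      intro m
      rcases hε with rfl | rfl <;> simp [abs_mul]
    constructor
    · rintro ⟨δ', hr, hz, rfl⟩
      obtain ⟨m, hm0, rfl⟩ := (hδ _).1 hr
      exact ⟨m, hm0, (hm m).1.1 hz, by rw [(hm m).2, mul_assoc]⟩
    · rintro ⟨m, hm0, hz, rfl⟩
      exact ⟨_, (hδ _).2 ⟨m, hm0, rfl⟩, (hm m).1.2 hz, by rw [(hm m).2, mul_assoc]⟩
  have hpos : 0 ≤ |δ.2.1| * speed a b := mul_nonneg (abs_nonneg _) (speed_pos hs).le
  rw [HasLength, hset, turns]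
  split_ifs with hz
  · refine ⟨⟨1, one_pos, by simp [hz], by simp⟩, ?_⟩
    rintro L ⟨m, hm, -, rfl⟩
    exact mul_le_mul_of_nonneg_right (by exact_mod_cast hm) hpos
  · refine ⟨⟨5, by norm_num, ?_, by norm_num⟩, ?_⟩
    · rw [show ((5 : ℕ) : ZMod 5) = 0 from rfl, zero_mul]
    · rintro L ⟨m, hm, hmz, rfl⟩
      have hm5 : (m : ZMod 5) = 0 := by
        revert hz hmz
        generalize (m : ZMod 5) = y
        generalize δ.2.2 = z
        revert y z
        decide
      rw [ZMod.natCast_eq_zero_iff] at hm5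
      exact mul_le_mul_of_nonneg_right (by exact_mod_cast Nat.le_of_dvd hm hm5) hpos

theorem classify_sideMid (hs : Admissible (system a b)) (e : Bool)
    {l : List (Fin 4)} (hl : IsTreeWord l ![a, b]) (J : Fin 5) :
    (wordPerm l J ∈ ({1, 2} : Set (Fin 5)) → IsShort (sideMid J) (sgn e • ofGoldenL a b)) ∧
    (wordPerm l J ∈ ({3, 4} : Set (Fin 5)) → IsLong (sideMid J) (sgn e • ofGoldenL a b)) ∧
    (wordPerm l J = 5 → IsSaddleConnection (sideMid J) (sgn e • ofGoldenL a b)) := by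
  have ha : 0 < a := hs.1
  obtain ⟨q, hq0, hcyc, hmid⟩ := classify ((RingHom.fst ℝ (ZMod 5)).comp (RingHom.snd ℝ (ℝ × ZMod 5)))
    rfl l (system a b) hl
  -- With the time coordinate for `f`, the determinant is `0 * b - 1 * a`; this makes all lengths
  -- positive.
  have hq : q.2.1 ≠ 0 := hq0 (by
    change (0 : ℝ) * b - 1 * a ≠ 0
    linarith)
  have hcenter : ∀ (e : Bool) (J : Fin 5), (e, center (system a b) J) =
      (e, offset a b (sideMid J), offset 0 1 (sideMid J), 4 + cyclicIndex J) := by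
    intro e J
    rw [center_system, add_comm]; rfl
  set S := turns q.2.2 * (2 * goldenRatio * |q.2.1| * speed a b) with hS
  have hφ := Real.one_lt_goldenRatio
  have hS0 : 0 < S := by
    have h1 := speed_pos hs
    have h2 := abs_pos.2 hq
    have h3 : 0 < turns q.2.2 := by unfold turns; split_ifs <;> norm_num
    positivity
  have hd1 : ∀ {p e d}, p ∈ table →
      Cyc (system a b) (e, offset a b p, offset 0 1 p, 4 + d) (2 * (g * q)) →
      HasLength p (sgn e • ofGoldenL a b) S := by
    intro p e d hp h
    convert hasLength_of_cyc hs hp h using 1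
    -- `2 * 3 = 1` modulo 5; for the other period `2 * 3 ^ 2 = 3`, also a unit, so `turns` is the
    -- same for both.
    have h1 : (2 * (g * q)).2.2 = q.2.2 := by
      change 2 * (3 * q.2.2) = q.2.2
      generalize q.2.2 = z
      revert z; decide
    have h2 : (2 * (g * q)).2.1 = 2 * goldenRatio * q.2.1 := by
      change 2 * (goldenRatio * q.2.1) = _
      ring
    rw [h1, h2, abs_mul, abs_of_pos (by positivity : 0 < 2 * goldenRatio)]
  have hd2 : ∀ {p e d}, p ∈ table →
      Cyc (system a b) (e, offset a b p, offset 0 1 p, 4 + d) (2 * (g ^ 2 * q)) →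
      HasLength p (sgn e • ofGoldenL a b) (goldenRatio * S) := by
    intro p e d hp h
    convert hasLength_of_cyc hs hp h using 1
    have h1 : turns (2 * (g ^ 2 * q)).2.2 = turns q.2.2 := by
      have : (2 * (g ^ 2 * q)).2.2 = 0 ↔ q.2.2 = 0 := by
        change 2 * (3 ^ 2 * q.2.2) = 0 ↔ q.2.2 = 0
        generalize q.2.2 = z
        revert z; decide
      simp only [turns, this]
    have h2 : (2 * (g ^ 2 * q)).2.1 = 2 * goldenRatio * q.2.1 * goldenRatio := by
      change 2 * (goldenRatio ^ 2 * q.2.1) = _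
      ring
    rw [h1, h2, abs_mul, abs_mul, abs_of_pos (by positivity : 0 < 2 * goldenRatio),
      abs_of_pos (by positivity : 0 < goldenRatio), hS]
    ring
  have hshort : ∀ {J}, wordPerm l J ∈ ({1, 2} : Set (Fin 5)) →
      HasLength (sideMid J) (sgn e • ofGoldenL a b) S := by
    intro J hJ
    have := (hmid J e).1 hJ
    rw [hcenter] at this
    exact hd1 (sideMid_mem_table J) this
  have hlong : ∀ {J}, wordPerm l J ∈ ({3, 4} : Set (Fin 5)) →
      HasLength (sideMid J) (sgn e • ofGoldenL a b) (goldenRatio * S) := by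
    intro J hJ
    have := (hmid J e).2.1 hJ
    rw [hcenter] at this
    exact hd2 (sideMid_mem_table J) this
  have hlen : lengths (sgn e • ofGoldenL a b) = {S, goldenRatio * S} := by
    ext L
    constructor
    · rintro ⟨p, hp, hL⟩
      obtain ⟨δ, hδ, -⟩ := (returnsAfter_iff hs hp e 0 L).1 hL.1
      obtain ⟨c, hc, hcy⟩ := hcyc _ _ hδ
      rcases hc with rfl | rfl
      · exact Or.inl (hL.unique (hd1 hp hcy))
      · exact Or.inr (hL.unique (hd2 hp hcy))
    · rintro (rfl | rfl)
      · obtain ⟨J, hJ⟩ := (wordPerm l).surjective 1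
        exact ⟨_, sideMid_mem_table J, hshort (by rw [hJ]; simp)⟩
      · obtain ⟨J, hJ⟩ := (wordPerm l).surjective 3
        exact ⟨_, sideMid_mem_table J, hlong (by rw [hJ]; simp)⟩
  have hlt : S < goldenRatio * S := by nlinarith
  refine ⟨fun h => ⟨S, hshort h, ?_⟩, fun h => ⟨_, hlong h, ?_⟩, fun h => ?_⟩
  · rw [hlen]
    exact ⟨⟨Or.inl rfl, by rintro _ (rfl | rfl) <;> simp [hlt.le]⟩, _, Or.inr rfl, hlt⟩
  · rw [hlen]
    exact ⟨⟨Or.inr rfl, by rintro _ (rfl | rfl) <;> simp [hlt.le]⟩, _, Or.inl rfl, hlt⟩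
  · have key : ∀ e, HitsCorner (sideMid J) (sgn e • ofGoldenL a b) := by
      intro e
      have := (hmid J e).2.2 h
      rw [hcenter] at this
      exact hitsCorner_of_dies hs (sideMid_mem_table J) this
    refine ⟨key e, ?_⟩
    have := key (!e)
    rwa [sgn_not, neg_smul] at this

/-- An odd return is traversed twice, because only even ones are returns of the transverse system.
-/
theorem exists_treeWord_of_returnsAfter (hs : Admissible (system a b)) {e : Bool} {n : ℕ} {L : ℝ}
    (hp : p ∈ table) (hn : 0 < n) (h : ReturnsAfter p (sgn e • ofGoldenL a b) n L) :
    ∃ l, IsTreeWord l ![a, b] := by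
  obtain ⟨δ, ⟨m, hm, hpath, hδ⟩, -⟩ := (returnsAfter_iff hs hp e 0 _).1
    ⟨n + n, by omega, ⟨n, rfl⟩, h.twice hn⟩
  exact exists_treeWord m hm (system a b) hs _ δ hδ hpath

end PentagonBilliard

/-! ### Transport by symmetries and reduction to the first quadrant -/

namespace PentagonBilliard
open Real (sin goldenRatio)

section transport
variable {A : Plane ≃ₗᵢ[ℝ] Plane} {π : Equiv.Perm (Fin 5)} {p v q w : Plane} {n : ℕ} {L : ℝ}

theorem BilliardPath.map (hA : IsTableSymmetry A π) (h : BilliardPath p v n L q w) :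
    BilliardPath (A p) (A v) n L (A q) (A w) := by
  induction h with
  | start => exact .start
  | @bounce n L q w h t ht j hside hout ih =>
    have hq : A q + t • A w = A (q + t • w) := by simp
    have := ih.bounce t ht (π j) (by rwa [hq, hA.mem_openSide]) (by rwa [hA.inner_normal])
    rw [hq, hA.reflect, norm_smul, A.norm_map, ← norm_smul] at this
    exact this

theorem ReturnsAfter.map (hA : IsTableSymmetry A π) (h : ReturnsAfter p v n L) :
    ReturnsAfter (A p) (A v) n L := by
  obtain ⟨L₀, q, s, hb, hs, rfl, rfl⟩ := h
  exact ⟨L₀, A q, s, hb.map hA, hs, by simp, by rw [norm_smul, norm_smul, A.norm_map]⟩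

theorem returnsAfter_map_iff (hA : IsTableSymmetry A π) :
    ReturnsAfter (A p) (A v) n L ↔ ReturnsAfter p v n L :=
  ⟨fun h => by simpa using h.map hA.symm, .map hA⟩

theorem hasLength_map_iff (hA : IsTableSymmetry A π) :
    HasLength (A p) (A v) L ↔ HasLength p v L := by
  simp only [HasLength, returnsAfter_map_iff hA]

theorem lengths_map (hA : IsTableSymmetry A π) : lengths (A v) = lengths v := by
  ext L
  constructor
  · rintro ⟨p, hp, h⟩
    refine ⟨A.symm p, by rwa [hA.symm.mem_table], ?_⟩
    rw [← hasLength_map_iff hA]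
    simpa using h
  · rintro ⟨p, hp, h⟩
    exact ⟨A p, by rwa [hA.mem_table], (hasLength_map_iff hA).2 h⟩

theorem HitsCorner.map (hA : IsTableSymmetry A π) (h : HitsCorner p v) :
    HitsCorner (A p) (A v) := by
  obtain ⟨n, L, q, w, t, hb, ht, hc⟩ := h
  exact ⟨n, L, A q, A w, t, hb.map hA, ht, by simpa using hA.mem_corners hc⟩

theorem isShort_map_iff (hA : IsTableSymmetry A π) : IsShort (A p) (A v) ↔ IsShort p v := by
  simp only [IsShort, hasLength_map_iff hA, lengths_map hA]

theorem isLong_map_iff (hA : IsTableSymmetry A π) : IsLong (A p) (A v) ↔ IsLong p v := by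
  simp only [IsLong, hasLength_map_iff hA, lengths_map hA]

theorem IsSaddleConnection.map (hA : IsTableSymmetry A π) (h : IsSaddleConnection p v) :
    IsSaddleConnection (A p) (A v) :=
  ⟨h.1.map hA, by simpa using h.2.map hA⟩

end transport

theorem toGoldenL_ofGoldenL (a b : ℝ) : toGoldenL (ofGoldenL a b) = ![a, b] := by
  have hdet : IsUnit P.det := by
    rw [P, Matrix.det_fin_two_of]; simpa using sin_pi_div_five_pos.ne'
  have h : P.mulVec ![a, b] = (ofGoldenL a b).ofLp := by
    ext i
    fin_cases i
    · simp only [P, ofGoldenL, cos_pi_div_five_eq]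
      simp [Matrix.mulVec, dotProduct, Fin.sum_univ_two]
    · simp [P, ofGoldenL, Matrix.mulVec, dotProduct, Fin.sum_univ_two]
  rw [toGoldenL, ← h, Matrix.mulVec_mulVec, Matrix.nonsing_inv_mul _ hdet, Matrix.one_mulVec]

theorem inFirstQuadrant_iff (u : Plane) : InFirstQuadrant (toGoldenL u) ↔
    inner ℝ u (normal 1) < 0 ∧ inner ℝ u (normal 0) ≤ 0 := by
  obtain ⟨a, b, rfl⟩ : ∃ a b, u = ofGoldenL a b := ⟨_, _, (ofGoldenL_toGoldenL u).symm⟩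
  have hs := sin_pi_div_five_pos
  have h1 : inner ℝ (ofGoldenL a b) (normal 1) = -(sin (Real.pi / 5) * a) := by
    rw [inner_ofGoldenL]; simp [width, isFwd, sgn]; exact Or.inl rfl
  have h0 : inner ℝ (ofGoldenL a b) (normal 0) = -(sin (Real.pi / 5) * b) := by
    rw [inner_ofGoldenL]; simp [width, isFwd, sgn]; exact Or.inl rfl
  rw [toGoldenL_ofGoldenL, h1, h0, neg_neg_iff_pos, neg_nonpos, mul_pos_iff_of_pos_left hs,
    mul_nonneg_iff_of_pos_left hs]
  rfl

theorem inner_flip (j i : Fin 5) (x : Plane) :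
    inner ℝ (flip j x) (normal i) = inner ℝ x (normal (flipPerm j i)) := by
  have h : flipPerm j (flipPerm j i) = i := (flipPerm j).left_inv i
  have := (isTableSymmetry_flip j).inner_normal x (flipPerm j i)
  rwa [h] at this

/-- Up to symmetry and sign, the normal with the largest `|⟨v, n⟩|` is that of side 3, with a
nonpositive product. Then `⟨u, nₖ + n₃⟩ ≤ 0` for all `k`, and `n₂ + n₃`, `n₄ + n₃` are positive
multiples of `n₁`, `n₀`, whose products with `u` are negative multiples of the golden coordinates.
-/
theorem exists_inFirstQuadrant {v : Plane} (hv : v ≠ 0) :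
    ∃ (A : Plane ≃ₗᵢ[ℝ] Plane) (π : Equiv.Perm (Fin 5)) (u : Plane),
      IsTableSymmetry A π ∧ (u = A v ∨ u = -A v) ∧ InFirstQuadrant (toGoldenL u) := by
  obtain ⟨i, hi⟩ := Finite.exists_max fun i => |inner ℝ v (normal i)|
  obtain ⟨j, hj⟩ : ∃ j, flipPerm j 3 = i := by clear hi; revert i; decide
  obtain ⟨u, hu, h3⟩ : ∃ u, (u = flip j v ∨ u = -flip j v) ∧
      inner ℝ u (normal 3) = -|inner ℝ v (normal i)| := by
    rcases abs_cases (inner ℝ v (normal i)) with ⟨h, -⟩ | ⟨h, -⟩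
    · exact ⟨_, .inr rfl, by rw [inner_neg_left, inner_flip, hj, h]⟩
    · exact ⟨_, .inl rfl, by rw [inner_flip, hj, h, neg_neg]⟩
  have hle : ∀ k, inner ℝ u (normal k) + inner ℝ u (normal 3) ≤ 0 := by
    intro k
    have h1 := hi (flipPerm j k)
    rw [h3, add_neg_le_iff_le_add, zero_add]
    refine le_trans ?_ h1
    rcases hu with rfl | rfl
    · rw [inner_flip]; exact le_abs_self _
    · rw [inner_neg_left, inner_flip]; exact neg_le_abs _
  have hφ := Real.one_lt_goldenRatio
  have hq := Real.goldenRatio_sq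
  have h1 : inner ℝ u (normal 1) ≤ 0 := by
    have := hle 2
    simp [inner_eq, normal_eq] at this ⊢
    have := mul_le_mul_of_nonneg_left this Real.goldenRatio_pos.le
    linear_combination this + u 0 * sin (Real.pi / 5) * hq
  have h0 : inner ℝ u (normal 0) ≤ 0 := by
    have := hle 4
    simp [inner_eq, normal_eq] at this ⊢
    have := mul_le_mul_of_nonneg_left this Real.goldenRatio_pos.le
    linear_combination this + u 1 * hq
  rcases h1.lt_or_eq with h1 | h1
  · exact ⟨flip j, flipPerm j, u, isTableSymmetry_flip j, hu, (inFirstQuadrant_iff u).2 ⟨h1, h0⟩⟩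
  -- On the excluded boundary ray, the symmetry fixing side 3 exchanges sides 0 and 1 and hence the
  -- two golden coordinates.
  · refine ⟨(flip j).trans (flip 3), flipPerm 3 * flipPerm j, flip 3 u,
      (isTableSymmetry_flip 3).mul (isTableSymmetry_flip j), ?_, (inFirstQuadrant_iff _).2 ?_⟩
    · rcases hu with rfl | rfl
      · exact .inl rfl
      · exact .inr (map_neg _ _)
    · rw [inner_flip, inner_flip, show flipPerm 3 1 = 0 by decide, show flipPerm 3 0 = 1 by decide]
      refine ⟨h0.lt_of_ne fun h => hv ?_, h1.le⟩
      have hu0 : u = 0 := by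
        have hs := sin_pi_div_five_pos.ne'
        simp [inner_eq, normal_eq] at h h1
        rw [h] at h1
        ext i
        fin_cases i
        · simpa [hs] using h1
        · simpa using h
      rcases hu with rfl | rfl
      · simpa using hu0
      · simpa using hu0

end PentagonBilliard

theorem theorem1 (v : Plane) (hv : IsPeriodicDirection v) :
    (∃ (A : Plane ≃ₗᵢ[ℝ] Plane) (π : Equiv.Perm (Fin 5)) (u : Plane),
      IsTableSymmetry A π ∧ (u = A v ∨ u = -A v) ∧ InFirstQuadrant (toGoldenL u)) ∧
    ∀ (A : Plane ≃ₗᵢ[ℝ] Plane) (π : Equiv.Perm (Fin 5)) (u : Plane),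
      IsTableSymmetry A π → (u = A v ∨ u = -A v) → InFirstQuadrant (toGoldenL u) →
        (∃! a : List (Fin 4), a.head? ≠ some 0 ∧ IsTreeWord a (toGoldenL u)) ∧
        ∀ a : List (Fin 4), IsTreeWord a (toGoldenL u) → ∀ J : Fin 5,
          (wordPerm a (π J) ∈ ({1, 2} : Set (Fin 5)) → IsShort (sideMid J) v) ∧
          (wordPerm a (π J) ∈ ({3, 4} : Set (Fin 5)) → IsLong (sideMid J) v) ∧
          (wordPerm a (π J) = 5 → IsSaddleConnection (sideMid J) v) := by
  refine ⟨exists_inFirstQuadrant hv.1, fun A π u hA hu hquad => ?_⟩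
  obtain ⟨-, p, hp, n, hn, L, hret⟩ := hv
  obtain ⟨a, b, rfl⟩ : ∃ a b, u = ofGoldenL a b := ⟨_, _, (ofGoldenL_toGoldenL u).symm⟩
  obtain ⟨e, he⟩ : ∃ e, A v = sgn e • ofGoldenL a b := by
    rcases hu with h | h
    · exact ⟨true, by simp [sgn, h]⟩
    · exact ⟨false, by simp [sgn, h]⟩
  rw [toGoldenL_ofGoldenL] at hquad ⊢
  have hs : Admissible (system a b) := hquad
  have hret' := hret.map hA
  rw [he] at hret'
  have hp' := (hA.mem_table p).2 hp
  obtain ⟨l, hl⟩ := exists_treeWord_of_returnsAfter hs hp' hn hret'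
  refine ⟨?_, fun l hl J => ?_⟩
  · obtain ⟨l', h1, h2⟩ := hl.exists_reduced
    exact ⟨l', ⟨h1, h2⟩, fun l'' h => h.2.unique h.1 h1 h2⟩
  · obtain ⟨h1, h2, h3⟩ := classify_sideMid hs e hl (π J)
    rw [← hA J, ← he] at h1 h2 h3
    refine ⟨fun h => (isShort_map_iff hA).1 (h1 h), fun h => (isLong_map_iff hA).1 (h2 h),
      fun h => ?_⟩
    simpa using (h3 h).map hA.symm
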